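/- Let $\mathcal X\subset\mathbb R^{d_x}$ and $\mathcal C\subset\mathbb R^{d_c}$ be compact, let $P$ be a probability distribution on $\mathcal X\times\mathcal C$ with second marginal $P_C$ (the law of the condition), and let $P_{X|C=c}$ be a regular conditional distribution. All norms are Euclidean. Put $\mathcal Z=\mathcal C\times\mathcal C$ and $\nu=P_C\otimes P_C$. For independent $(X_1,C_1),(X_2,C_2)\sim P$, let $Q^1$ and $Q^2$ be the laws of $(X_1,C_1,C_2)$ and $(X_2,C_1,C_2)$ on $\mathcal X\times\mathcal Z$. Let $\Gamma^4_\nu(Q^1,Q^2)$ be the set of couplings $\Pi$ of $Q^1$ and $Q^2$, as laws of $((x_1,z_1),(x_2,z_2))$, whose $(z_1,z_2)$-marginal is the image of $\nu$ under $z\mapsto(z,z)$, and put $$W_{2,\nu}(Q^1,Q^2)^2=\inf_{\Pi\in\Gamma^4_\nu(Q^1,Q^2)}\int\|(x_1,z_1)-(x_2,z_2)\|^2\,d\Pi .$$ Let $(x_1^{(i)},c_1^{(i)})_{i\ge1}$ and $(x_2^{(i)},c_2^{(i)})_{i\ge1}$ be two independent i.i.d. samples from $P$, and put $z^{(i)}=(c_1^{(i)},c_2^{(i)})$.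 For $\beta>0$ and $N\ge1$, an empirical optimal coupling $\Pi_N^\beta$ is a measure $$\frac1N\sum_{i=1}^N\delta_{((x_1^{(i)},z^{(i)}),(x_2^{(\pi(i))},z^{(\pi(i))}))},$$ where $\pi$ minimizes over the permutations of $\{1,\dots,N\}$ $$\sum_{i=1}^N\|x_1^{(i)}-x_2^{(\pi(i))}\|^2+\beta\bigl(\|c_1^{(i)}-c_1^{(\pi(i))}\|^2+\|c_2^{(i)}-c_2^{(\pi(i))}\|^2\bigr),$$ or, more generally, any optimal transport plan for the cost $\|x_1-x_2\|^2+\beta\|z_1-z_2\|^2$ between the empirical distributions of $\{(x_1^{(i)},z^{(i)})\}_{i\le N}$ and $\{(x_2^{(i)},z^{(i)})\}_{i\le N}$. Let $\beta_k>0$ with $\beta_k\to\infty$. **Theorem.** (i) There are sample sizes $1\le N_1<N_2<\cdots$ such that almost surely, for every choice of empirical optimal couplings $\Pi_{N_k}^{\beta_k}$, every subsequence of $(\Pi_{N_k}^{\beta_k})_k$ has a further subsequence that converges in $W_2$, as measures on $(\mathcal X\times\mathcal Z)^2$, to some $\Pi\in\Gamma^4_\nu(Q^1,Q^2)$ that is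 an optimal plan for $W_{2,\nu}(Q^1,Q^2)$. If the optimal plan $\Pi$ for $W_{2,\nu}(Q^1,Q^2)$ is unique, then the whole sequence $\Pi_{N_k}^{\beta_k}$ converges to $\Pi$ in $W_2$. Let now $\Pi$ be any optimal plan for $W_{2,\nu}(Q^1,Q^2)$, in particular any limit in (i), and let $(\Pi_{c_1,c_2})$ be a disintegration over $z=(c_1,c_2)$ of the law of $(x_1,x_2,z)$ under $\Pi$, where $z=z_1=z_2$ almost surely. (ii) $$\int_{\mathcal C\times\mathcal C}\int_{\mathcal X\times\mathcal X}\|x_1-x_2\|^2\,d\Pi_{c_1,c_2}(x_1,x_2)\,d\nu(c_1,c_2)=\int_{\mathcal C\times\mathcal C}W_2^2(P_{X|C=c_1},P_{X|C=c_2})\,d\nu(c_1,c_2).$$ (iii) For $\nu$-almost every $(c_1,c_2)$, $\Pi_{c_1,c_2}$ is an optimal transport plan for $W_2(P_{X|C=c_1},P_{X|C=c_2})$, that is, a coupling of these two measures that attains the infimum of $\int\|x_1-x_2\|^2$. -/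

import Mathlib

open MeasureTheory ProbabilityTheory Filter Topology
open scoped ENNReal

noncomputable section

namespace A2A

/-! ### Optimal transport -/

section Transport

variable {A : Type*} [MeasurableSpace A]

/-- `Γ(μ, ν)`: the couplings of `μ` and `ν`. -/
def couplings (μ ν : Measure A) : Set (Measure (A × A)) :=
  {γ | γ.map Prod.fst = μ ∧ γ.map Prod.snd = ν}

/-- The total cost `∫ c(a, b) dγ(a, b)` of a plan `γ` for a nonnegative cost function `c`. -/
def planCost (c : A → A → ℝ) (γ : Measure (A × A)) : ℝ≥0∞ :=
  ∫⁻ w, ENNReal.ofReal (c w.1 w.2) ∂γ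

/-- The Kantorovich infimum of the cost `c` over all couplings of `μ` and `ν`. -/
def optimalCost (c : A → A → ℝ) (μ ν : Measure A) : ℝ≥0∞ :=
  ⨅ γ ∈ couplings μ ν, planCost c γ

/-- `γ` is an optimal transport plan between `μ` and `ν` for the cost `c`. -/
def IsOptimalPlan (c : A → A → ℝ) (μ ν : Measure A) (γ : Measure (A × A)) : Prop :=
  γ ∈ couplings μ ν ∧ planCost c γ = optimalCost c μ ν

/-- The empirical distribution `(1/N) ∑ δ_{a i}` of `N` points. -/
def empirical {N : ℕ} (a : Fin N → A) : Measure A :=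
  (N : ℝ≥0∞)⁻¹ • ∑ i, Measure.dirac (a i)

end Transport

/-- The squared Euclidean distance. -/
def sqDist {n : ℕ} (x y : EuclideanSpace ℝ (Fin n)) : ℝ := ‖x - y‖ ^ 2

/-! ### The observation, condition and augmented spaces -/

variable {dx dc : ℕ}

/-- The ambient space of a pair of conditions `z = (c₁, c₂)`. -/
abbrev CondPair (dc : ℕ) : Type := EuclideanSpace ℝ (Fin dc) × EuclideanSpace ℝ (Fin dc)

/-- The ambient space of an augmented datum `(x, z) = (x, (c₁, c₂))`. -/
abbrev Aug (dx dc : ℕ) : Type := EuclideanSpace ℝ (Fin dx) × CondPair dc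

/-- `d_β((x₁, z₁), (x₂, z₂)) = ‖x₁ - x₂‖² + β ‖z₁ - z₂‖²`, all norms being Euclidean.
For `β = 1` it is the squared Euclidean distance of the augmented space. -/
def augCost (β : ℝ) (p q : Aug dx dc) : ℝ :=
  sqDist p.1 q.1 + β * (sqDist p.2.1 q.2.1 + sqDist p.2.2 q.2.2)

/-- The squared Euclidean distance between two points of the square of the augmented space. -/
def augPairCost (v w : Aug dx dc × Aug dx dc) : ℝ :=
  augCost 1 v.1 w.1 + augCost 1 v.2 w.2

/-- The Wasserstein distance `W₂` between two plans, i.e. between probability measures on the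
square of the augmented space. -/
def planW2 (γ γ' : Measure (Aug dx dc × Aug dx dc)) : ℝ≥0∞ :=
  (optimalCost augPairCost γ γ') ^ (1 / 2 : ℝ)

/-! ### The population distributions -/

/-- `ν`, the law of `(C₁, C₂)`: the square of the condition marginal of `P`. -/
def condLaw (P : Measure (EuclideanSpace ℝ (Fin dx) × EuclideanSpace ℝ (Fin dc))) :
    Measure (CondPair dc) :=
  (P.map Prod.snd).prod (P.map Prod.snd)

/-- `Q¹`, the law of `(X₁, C₁, C₂)` for `((X₁, C₁), (X₂, C₂)) ∼ P ⊗ P`. -/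
def augLaw₁ (P : Measure (EuclideanSpace ℝ (Fin dx) × EuclideanSpace ℝ (Fin dc))) :
    Measure (Aug dx dc) :=
  (P.prod P).map (fun p => (p.1.1, (p.1.2, p.2.2)))

/-- `Q²`, the law of `(X₂, C₁, C₂)` for `((X₁, C₁), (X₂, C₂)) ∼ P ⊗ P`. -/
def augLaw₂ (P : Measure (EuclideanSpace ℝ (Fin dx) × EuclideanSpace ℝ (Fin dc))) :
    Measure (Aug dx dc) :=
  (P.prod P).map (fun p => (p.2.1, (p.1.2, p.2.2)))

/-! ### The conditional Wasserstein distance -/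

/-- `Γ⁴_ν(Q, R)`: the couplings of `Q` and `R` whose `(z₁, z₂)`-marginal is the image of `ν`
under the diagonal map. -/
def fourPlans (ν : Measure (CondPair dc)) (Q R : Measure (Aug dx dc)) :
    Set (Measure (Aug dx dc × Aug dx dc)) :=
  {γ | γ ∈ couplings Q R ∧ γ.map (fun w => (w.1.2, w.2.2)) = ν.map (fun z => (z, z))}

/-- The square of the conditional Wasserstein distance `W_{2,ν}(Q, R)`. -/
def condW2Sq (ν : Measure (CondPair dc)) (Q R : Measure (Aug dx dc)) : ℝ≥0∞ :=
  ⨅ γ ∈ fourPlans ν Q R, planCost (augCost 1) γ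

/-- `γ` is an optimal plan for `W_{2,ν}(Q, R)`. -/
def IsCondOptimalPlan (ν : Measure (CondPair dc)) (Q R : Measure (Aug dx dc))
    (γ : Measure (Aug dx dc × Aug dx dc)) : Prop :=
  γ ∈ fourPlans ν Q R ∧ planCost (augCost 1) γ = condW2Sq ν Q R

/-- The 3-plan of a 4-plan, the law of `(z, (x₁, x₂))` where `z = z₁` (and `z₁ = z₂` almost
surely). The condition is put first, as in Mathlib's disintegration of measures. -/
def threePlan (γ : Measure (Aug dx dc × Aug dx dc)) :
    Measure (CondPair dc × (EuclideanSpace ℝ (Fin dx) × EuclideanSpace ℝ (Fin dx))) :=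
  γ.map (fun w => (w.1.2, (w.1.1, w.2.1)))

/-! ### The empirical coupling

`D₁ i = (x₁⁽ⁱ⁾, c₁⁽ⁱ⁾)` and `D₂ i = (x₂⁽ⁱ⁾, c₂⁽ⁱ⁾)` are the two samples, of which the first `N`
points are used. -/

section Empirical

variable (N : ℕ) (D₁ D₂ : ℕ → EuclideanSpace ℝ (Fin dx) × EuclideanSpace ℝ (Fin dc))

/-- The augmented data `(x₁⁽ⁱ⁾, c₁⁽ⁱ⁾, c₂⁽ⁱ⁾)`. -/
def augData₁ (i : Fin N) : Aug dx dc := ((D₁ i).1, ((D₁ i).2, (D₂ i).2))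

/-- The augmented data `(x₂⁽ⁱ⁾, c₁⁽ⁱ⁾, c₂⁽ⁱ⁾)`. -/
def augData₂ (i : Fin N) : Aug dx dc := ((D₂ i).1, ((D₁ i).2, (D₂ i).2))

/-- The objective of the permutation `π`: the sum over `i` of
`‖x₁⁽ⁱ⁾ - x₂⁽π i⁾‖² + β (‖c₁⁽ⁱ⁾ - c₁⁽π i⁾‖² + ‖c₂⁽ⁱ⁾ - c₂⁽π i⁾‖²)`. -/
def a2aObjective (β : ℝ) (π : Equiv.Perm (Fin N)) : ℝ :=
  ∑ i : Fin N, (‖(D₁ i).1 - (D₂ (π i)).1‖ ^ 2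
    + β * (‖(D₁ i).2 - (D₁ (π i)).2‖ ^ 2 + ‖(D₂ i).2 - (D₂ (π i)).2‖ ^ 2))

/-- The atomic plan `(1/N) ∑ δ_{((x₁⁽ⁱ⁾, z⁽ⁱ⁾), (x₂⁽π i⁾, z⁽π i⁾))}` with `z⁽ⁱ⁾ = (c₁⁽ⁱ⁾, c₂⁽ⁱ⁾)`. -/
def permPlan (π : Equiv.Perm (Fin N)) : Measure (Aug dx dc × Aug dx dc) :=
  empirical (fun i => (augData₁ N D₁ D₂ i, augData₂ N D₁ D₂ (π i)))

/-- `γ` is an empirical optimal coupling: the plan of a permutation that minimizes the objective,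
or, more generally, any optimal transport plan for the cost `d_β` between the empirical
distributions of the two augmented data sets. -/
def IsEmpiricalOptimal (β : ℝ) (γ : Measure (Aug dx dc × Aug dx dc)) : Prop :=
  (∃ π : Equiv.Perm (Fin N),
      (∀ σ : Equiv.Perm (Fin N), a2aObjective N D₁ D₂ β π ≤ a2aObjective N D₁ D₂ β σ) ∧
      γ = permPlan N D₁ D₂ π) ∨
    IsOptimalPlan (augCost β) (empirical (augData₁ N D₁ D₂)) (empirical (augData₂ N D₁ D₂)) γ

end Empirical

end A2A

end

/-!
All measures live on compact sets, so the weak topology decides everything, and one construction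
carries both halves of the theorem. Cut the space by a continuous partition of unity `f` so fine
that the cost oscillates by at most `ε` on the products of the supports. A plan between `Q` and `Q'`
then matters only through the matrix of the masses that it gives to the products `f i ⊗ f j`, a
coupling of two finite distributions. Conversely, a coupling matrix of the weights `∫ f i` of two
measures lifts to a plan that has a density with respect to their product (`lift_mem_couplings`).
When the measures change, the matrix is corrected by an explicit formula (`transferMatrix`), at a
price proportional to the change of the weights (`sum_transferMatrix_le`).

* The weights are continuous for the weak topology, so the optimal cost is upper semicontinuous
  (`eventually_optimalCost_le`). In particular weak convergence implies convergence in `W₂`.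
* The formula is measurable in the weights, so nearly optimal plans between the values of two
  kernels can be selected measurably (`exists_measurable_nearly_optimal`), without a general
  measurable selection theorem.

For the convergence statement, let `V` be the squared conditional Wasserstein distance. A plan over
the diagonal has the same cost for every weight `β` of the conditions, so for fixed `β` the optimal
cost of the population laws is at most `V`. By upper semicontinuity and the law of large numbers,
the optimal cost for `β k` of the empirical laws is at most `V + 1 / k` with probability close to
one for large samples, and the Borel–Cantelli lemma provides sample sizes for which this holds
almost surely for large `k` (`exists_sampleSizes`). By the Prokhorov theorem the empirical optimal
couplings have weak limit points. By lower semicontinuity the cost of a limit point is at most `V`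
for every weight `β`; hence it is carried by the diagonal and is optimal
(`isCondOptimalPlan_of_forall_planCost_le`). That an optimal permutation is an optimal plan is the
Birkhoff theorem (`IsEmpiricalOptimal.isOptimalPlan`).

For the fibres of an optimal plan, replace them by measurably selected nearly optimal plans between
the conditional laws. The result is again a plan over the diagonal, so it costs at least `V`, and
hence almost every fibre was optimal already (`ae_planCost_eq_optimalCost`,
`ae_isOptimalPlan_of_isCondOptimalPlan`).
-/

namespace A2A

/-! ### General couplings -/

lemma isProbabilityMeasure_of_mem_couplings {A : Type*} [MeasurableSpace A] {μ ν : Measure A}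
    [IsProbabilityMeasure μ] {γ : Measure (A × A)} (h : γ ∈ couplings μ ν) :
    IsProbabilityMeasure γ := by
  constructor
  rw [← Set.preimage_univ (f := Prod.fst), ← Measure.map_apply measurable_fst MeasurableSet.univ,
    h.1, measure_univ]

lemma measure_prod_compl_eq_zero_of_mem_couplings {A : Type*} [MeasurableSpace A]
    {μ ν : Measure A} {γ : Measure (A × A)} (h : γ ∈ couplings μ ν) {K : Set A}
    (hμ : μ Kᶜ = 0) (hν : ν Kᶜ = 0) : γ (K ×ˢ K)ᶜ = 0 := by
  have h1 : ∀ᵐ w ∂γ, w.1 ∈ K :=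
    ae_of_ae_map measurable_fst.aemeasurable (h.1.symm ▸ mem_ae_iff.2 hμ)
  have h2 : ∀ᵐ w ∂γ, w.2 ∈ K :=
    ae_of_ae_map measurable_snd.aemeasurable (h.2.symm ▸ mem_ae_iff.2 hν)
  have : ∀ᵐ w ∂γ, w ∈ K ×ˢ K := by
    filter_upwards [h1, h2] with w hw1 hw2 using ⟨hw1, hw2⟩
  exact mem_ae_iff.1 this

/-! ### Couplings of finite distributions -/

section FiniteTransport

variable {ι : Type*} [Fintype ι]

/-- `t` is a coupling of the weight vectors `p` (row sums) and `q` (column sums). -/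
structure IsCouplingMatrix (p q : ι → ℝ≥0∞) (t : ι → ι → ℝ≥0∞) : Prop where
  row : ∀ i, ∑ j, t i j = p i
  col : ∀ j, ∑ i, t i j = q j

/-- The part of the coupling `t` of `(p, q)` that is kept when the marginals are changed to
`(p', q')`: the row `i` is scaled by `min 1 (p' i / p i)`, the column `j` by
`min 1 (q' j / q j)`. Its marginals are at most `p'` and `q'`. -/
noncomputable def keptMatrix (p q : ι → ℝ≥0∞) (t : ι → ι → ℝ≥0∞) (p' q' : ι → ℝ≥0∞) (i j : ι) :
    ℝ≥0∞ :=
  t i j * (min 1 (p' i / p i) * min 1 (q' j / q j))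

/-- A coupling of `(p', q')` obtained from the coupling `t` of `(p, q)`: the missing parts of the
marginals of `keptMatrix` are coupled independently. It depends measurably on `(p', q')`. -/
noncomputable def transferMatrix (p q : ι → ℝ≥0∞) (t : ι → ι → ℝ≥0∞) (p' q' : ι → ℝ≥0∞)
    (i j : ι) : ℝ≥0∞ :=
  keptMatrix p q t p' q' i j +
    (p' i - ∑ l, keptMatrix p q t p' q' i l) * (q' j - ∑ l, keptMatrix p q t p' q' l j) /
      ∑ k, (p' k - ∑ l, keptMatrix p q t p' q' k l)

lemma mul_min_one_div_le (a b : ℝ≥0∞) : a * min 1 (b / a) ≤ b :=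
  (mul_le_mul_right (min_le_right _ _) a).trans ENNReal.mul_div_le

lemma mul_one_sub_min_one_div_le {a : ℝ≥0∞} (ha : a ≠ ∞) (b : ℝ≥0∞) :
    a * (1 - min 1 (b / a)) ≤ a - b := by
  rcases eq_or_ne a 0 with rfl | h0
  · simp
  rcases le_total 1 (b / a) with h | h
  · simp [min_eq_left h]
  · rw [min_eq_right h, ENNReal.mul_sub (fun _ _ => ha), mul_one, ENNReal.mul_div_cancel h0 ha]

lemma one_le_mul_add_one_sub {r s : ℝ≥0∞} (hr : r ≤ 1) (hs : s ≤ 1) :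
    1 ≤ r * s + (1 - r) + (1 - s) := by
  calc (1 : ℝ≥0∞) = s + (1 - s) := (add_tsub_cancel_of_le hs).symm
    _ = (r + (1 - r)) * s + (1 - s) := by rw [add_tsub_cancel_of_le hr, one_mul]
    _ = r * s + (1 - r) * s + (1 - s) := by rw [add_mul]
    _ ≤ r * s + (1 - r) + (1 - s) := by
      gcongr
      exact mul_le_of_le_one_right' hs

variable {p q p' q' : ι → ℝ≥0∞} {t : ι → ι → ℝ≥0∞}

lemma keptMatrix_row_le (h : IsCouplingMatrix p q t) (i : ι) :
    ∑ j, keptMatrix p q t p' q' i j ≤ p' i :=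
  calc ∑ j, keptMatrix p q t p' q' i j ≤ ∑ j, t i j * min 1 (p' i / p i) := by
        refine Finset.sum_le_sum fun j _ => mul_le_mul_right ?_ _
        exact mul_le_of_le_one_right' (min_le_left _ _)
    _ = p i * min 1 (p' i / p i) := by rw [← Finset.sum_mul, h.row]
    _ ≤ p' i := mul_min_one_div_le _ _

lemma keptMatrix_col_le (h : IsCouplingMatrix p q t) (j : ι) :
    ∑ i, keptMatrix p q t p' q' i j ≤ q' j :=
  calc ∑ i, keptMatrix p q t p' q' i j ≤ ∑ i, t i j * min 1 (q' j / q j) := by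
        refine Finset.sum_le_sum fun i _ => mul_le_mul_right ?_ _
        exact mul_le_of_le_one_left' (min_le_left _ _)
    _ = q j * min 1 (q' j / q j) := by rw [← Finset.sum_mul, h.col]
    _ ≤ q' j := mul_min_one_div_le _ _

lemma sum_deficit_row (h : IsCouplingMatrix p q t) :
    ∑ i, (p' i - ∑ j, keptMatrix p q t p' q' i j) + ∑ i, ∑ j, keptMatrix p q t p' q' i j
      = ∑ i, p' i := by
  rw [← Finset.sum_add_distrib]
  exact Finset.sum_congr rfl fun i _ => tsub_add_cancel_of_le (keptMatrix_row_le h i)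

lemma sum_deficit_col (h : IsCouplingMatrix p q t) :
    ∑ j, (q' j - ∑ i, keptMatrix p q t p' q' i j) + ∑ i, ∑ j, keptMatrix p q t p' q' i j
      = ∑ j, q' j := by
  rw [Finset.sum_comm, ← Finset.sum_add_distrib]
  exact Finset.sum_congr rfl fun i _ => tsub_add_cancel_of_le (keptMatrix_col_le h i)

lemma sum_keptMatrix_ne_top (h : IsCouplingMatrix p q t) (hp' : ∑ i, p' i = 1) :
    ∑ i, ∑ j, keptMatrix p q t p' q' i j ≠ ∞ := by
  refine ne_top_of_le_ne_top ENNReal.one_ne_top (hp' ▸ ?_)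
  exact Finset.sum_le_sum fun i _ => keptMatrix_row_le h i

lemma sum_deficit_eq (h : IsCouplingMatrix p q t) (hp' : ∑ i, p' i = 1) (hq' : ∑ i, q' i = 1) :
    ∑ j, (q' j - ∑ i, keptMatrix p q t p' q' i j)
      = ∑ i, (p' i - ∑ j, keptMatrix p q t p' q' i j) := by
  refine (ENNReal.add_left_inj (sum_keptMatrix_ne_top (q' := q') h hp')).1 ?_
  rw [sum_deficit_col h, sum_deficit_row h, hp', hq']

/-- The mass that is coupled independently is at most the total loss of the weights. -/
lemma sum_deficit_le (h : IsCouplingMatrix p q t) (hp : ∑ i, p i = 1)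
    (hp' : ∑ i, p' i = 1) :
    ∑ i, (p' i - ∑ j, keptMatrix p q t p' q' i j) ≤ ∑ i, (p i - p' i) + ∑ j, (q j - q' j) := by
  have hpi : ∀ i, p i ≠ ∞ := fun i => ne_top_of_le_ne_top ENNReal.one_ne_top
    (hp ▸ Finset.single_le_sum (fun _ _ => zero_le) (Finset.mem_univ i))
  have hsum : ∑ j, q j = 1 := by
    rw [← hp, ← Finset.sum_congr rfl fun j _ => h.col j, Finset.sum_comm]
    exact Finset.sum_congr rfl fun i _ => h.row i
  have hqi : ∀ i, q i ≠ ∞ := fun i => ne_top_of_le_ne_top ENNReal.one_ne_top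
    (hsum ▸ Finset.single_le_sum (fun _ _ => zero_le) (Finset.mem_univ i))
  refine (ENNReal.add_le_add_iff_right (sum_keptMatrix_ne_top (q' := q') h hp')).1 ?_
  rw [sum_deficit_row h, hp']
  calc (1 : ℝ≥0∞) = ∑ i, ∑ j, t i j := by
        rw [← hp]; exact Finset.sum_congr rfl fun i _ => (h.row i).symm
    _ ≤ ∑ i, ∑ j, (keptMatrix p q t p' q' i j + t i j * (1 - min 1 (p' i / p i))
          + t i j * (1 - min 1 (q' j / q j))) := by
        refine Finset.sum_le_sum fun i _ => Finset.sum_le_sum fun j _ => ?_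
        rw [keptMatrix, ← mul_add, ← mul_add]
        exact le_mul_of_one_le_right' (one_le_mul_add_one_sub (min_le_left _ _) (min_le_left _ _))
    _ = ∑ i, ∑ j, keptMatrix p q t p' q' i j + ∑ i, p i * (1 - min 1 (p' i / p i))
          + ∑ j, q j * (1 - min 1 (q' j / q j)) := by
        simp only [Finset.sum_add_distrib, ← Finset.sum_mul, h.row]
        congr 1
        rw [Finset.sum_comm]
        simp only [← Finset.sum_mul, h.col]
    _ ≤ ∑ i, ∑ j, keptMatrix p q t p' q' i j + ∑ i, (p i - p' i) + ∑ j, (q j - q' j) := by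
        gcongr with i _ j _
        · exact mul_one_sub_min_one_div_le (hpi i) _
        · exact mul_one_sub_min_one_div_le (hqi j) _
    _ = _ := by ring

lemma isCouplingMatrix_transferMatrix (h : IsCouplingMatrix p q t) (hp' : ∑ i, p' i = 1)
    (hq' : ∑ i, q' i = 1) : IsCouplingMatrix p' q' (transferMatrix p q t p' q') := by
  have hfin : ∑ i, (p' i - ∑ j, keptMatrix p q t p' q' i j) ≠ ∞ :=
    ne_top_of_le_ne_top ENNReal.one_ne_top
      (hp' ▸ Finset.sum_le_sum fun i _ => tsub_le_self)
  -- when the missing mass vanishes, both factors of the independent part vanish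
  have key : ∀ (a : ι → ℝ≥0∞) (i : ι), ∑ k, a k ≠ ∞ → a i * ((∑ k, a k) / ∑ k, a k) = a i := by
    intro a i ha
    rcases eq_or_ne (∑ k, a k) 0 with h0 | h0
    · simp [(Finset.sum_eq_zero_iff.1 h0) i (Finset.mem_univ i)]
    · rw [ENNReal.div_self h0 ha, mul_one]
  constructor
  · intro i
    simp only [transferMatrix, Finset.sum_add_distrib, div_eq_mul_inv, ← Finset.sum_mul,
      ← Finset.mul_sum]
    rw [sum_deficit_eq h hp' hq', mul_assoc, ← div_eq_mul_inv, key _ i hfin]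
    exact add_tsub_cancel_of_le (keptMatrix_row_le h i)
  · intro j
    simp only [transferMatrix, Finset.sum_add_distrib, div_eq_mul_inv, ← Finset.sum_mul]
    rw [← sum_deficit_eq h hp' hq', mul_comm (∑ _, _), mul_assoc, ← div_eq_mul_inv,
      key (fun j => q' j - ∑ i, keptMatrix p q t p' q' i j) j (by rwa [sum_deficit_eq h hp' hq'])]
    exact add_tsub_cancel_of_le (keptMatrix_col_le h j)

/-- The cost of `transferMatrix` exceeds the cost of `t` by at most the loss of the weights times
the largest cost. -/
lemma sum_transferMatrix_le (h : IsCouplingMatrix p q t) (hp : ∑ i, p i = 1)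
    (hp' : ∑ i, p' i = 1) (hq' : ∑ i, q' i = 1) {M : ι → ι → ℝ≥0∞} {B : ℝ≥0∞}
    (hM : ∀ i j, M i j ≤ B) :
    ∑ i, ∑ j, transferMatrix p q t p' q' i j * M i j
      ≤ ∑ i, ∑ j, t i j * M i j + (∑ i, (p i - p' i) + ∑ j, (q j - q' j)) * B := by
  simp only [transferMatrix, add_mul, Finset.sum_add_distrib]
  refine add_le_add ?_ ?_
  · refine Finset.sum_le_sum fun i _ => Finset.sum_le_sum fun j _ => mul_le_mul_left ?_ _
    exact mul_le_of_le_one_right' (mul_le_one' (min_le_left _ _) (min_le_left _ _))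
  · rw [← add_mul]
    refine le_trans ?_ (mul_le_mul_left (sum_deficit_le (p' := p') (q' := q') h hp hp') B)
    calc _ ≤ ∑ i, ∑ j, (p' i - ∑ l, keptMatrix p q t p' q' i l) *
            (q' j - ∑ l, keptMatrix p q t p' q' l j) /
              (∑ k, (p' k - ∑ l, keptMatrix p q t p' q' k l)) * B := by
          gcongr with i _ j _
          exact hM i j
      _ = (∑ k, (p' k - ∑ l, keptMatrix p q t p' q' k l)) *
            ((∑ k, (p' k - ∑ l, keptMatrix p q t p' q' k l)) /
              (∑ k, (p' k - ∑ l, keptMatrix p q t p' q' k l))) * B := by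
          simp only [div_eq_mul_inv, ← Finset.sum_mul, ← Finset.mul_sum]
          rw [sum_deficit_eq h hp' hq', mul_assoc (∑ _, _)]
      _ ≤ _ := by
          gcongr
          exact mul_le_of_le_one_right' ENNReal.div_self_le_one

end FiniteTransport

/-! ### Lifting couplings of finite distributions -/

section Lift

variable {E : Type*} {ι : Type*} [Fintype ι]

/-- The density, with respect to the product of two measures with weights
`p i = ∫ f i` and `q j = ∫ f j`, of the plan that couples the pieces `f i` and `f j`
independently with total mass `t i j`. -/
noncomputable def liftDensity (f : ι → E → ℝ≥0∞) (p q : ι → ℝ≥0∞) (t : ι → ι → ℝ≥0∞) (w : E × E) :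
    ℝ≥0∞ :=
  ∑ i, ∑ j, t i j / (p i * q j) * (f i w.1 * f j w.2)

lemma liftDensity_swap (f : ι → E → ℝ≥0∞) (p q : ι → ℝ≥0∞) (t : ι → ι → ℝ≥0∞) (w : E × E) :
    liftDensity f p q t w.swap = liftDensity f q p (fun i j => t j i) w := by
  simp only [liftDensity, Prod.fst_swap, Prod.snd_swap]
  rw [Finset.sum_comm]
  simp only [mul_comm]

variable [MeasurableSpace E]

lemma measurable_liftDensity {f : ι → E → ℝ≥0∞} (hf : ∀ i, Measurable (f i)) (p q : ι → ℝ≥0∞)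
    (t : ι → ι → ℝ≥0∞) : Measurable (liftDensity f p q t) := by
  unfold liftDensity
  fun_prop

lemma IsCouplingMatrix.symm {p q : ι → ℝ≥0∞} {t : ι → ι → ℝ≥0∞} (h : IsCouplingMatrix p q t) :
    IsCouplingMatrix q p (fun i j => t j i) := ⟨h.col, h.row⟩

lemma IsCouplingMatrix.le_row {p q : ι → ℝ≥0∞} {t : ι → ι → ℝ≥0∞} (h : IsCouplingMatrix p q t)
    (i j : ι) : t i j ≤ p i :=
  h.row i ▸ Finset.single_le_sum (f := fun j => t i j) (fun _ _ => zero_le) (Finset.mem_univ j)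

lemma IsCouplingMatrix.le_col {p q : ι → ℝ≥0∞} {t : ι → ι → ℝ≥0∞} (h : IsCouplingMatrix p q t)
    (i j : ι) : t i j ≤ q j := h.symm.le_row j i

/-- Division by `q j` and multiplication by `q j` cancel, as `t i j` vanishes where `q j` does. -/
lemma IsCouplingMatrix.div_mul_mul {p q : ι → ℝ≥0∞} {t : ι → ι → ℝ≥0∞}
    (h : IsCouplingMatrix p q t) (hp : ∀ i, p i ≠ ∞) (hq : ∀ i, q i ≠ ∞) (i j : ι) :
    t i j / (p i * q j) * q j = t i j / p i := by
  rcases eq_or_ne (q j) 0 with h0 | h0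
  · have : t i j = 0 := le_antisymm (h0 ▸ h.le_col i j) zero_le
    simp [this, h0]
  · rw [div_eq_mul_inv, ENNReal.mul_inv (Or.inr (hq j)) (Or.inl (hp i)), mul_assoc, mul_assoc,
      ENNReal.inv_mul_cancel h0 (hq j), mul_one, div_eq_mul_inv]

variable {Q Q' : Measure E} {f : ι → E → ℝ≥0∞}

lemma lintegral_partition_eq_one [IsProbabilityMeasure Q] (hf : ∀ i, Measurable (f i))
    (hQ : ∀ᵐ x ∂Q, ∑ i, f i x = 1) : ∑ i, ∫⁻ x, f i x ∂Q = 1 := by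
  rw [← lintegral_finsetSum _ fun i _ => hf i, lintegral_congr_ae hQ]
  simp

lemma lintegral_partition_ne_top [IsProbabilityMeasure Q] (hf : ∀ i, Measurable (f i))
    (hQ : ∀ᵐ x ∂Q, ∑ i, f i x = 1) (i : ι) : ∫⁻ x, f i x ∂Q ≠ ∞ := by
  refine ne_top_of_le_ne_top ENNReal.one_ne_top (lintegral_partition_eq_one hf hQ ▸ ?_)
  exact Finset.single_le_sum (f := fun i => ∫⁻ x, f i x ∂Q) (fun _ _ => zero_le)
    (Finset.mem_univ i)

/-- The lifted plan has the first marginal `Q`. Pieces without weight, where the quotients in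
`liftDensity` are junk, are negligible; hence the equality only holds almost everywhere. -/
lemma lintegral_liftDensity_snd [IsProbabilityMeasure Q] [IsProbabilityMeasure Q']
    (hf : ∀ i, Measurable (f i))
    (hQ : ∀ᵐ x ∂Q, ∑ i, f i x = 1) (hQ' : ∀ᵐ x ∂Q', ∑ i, f i x = 1) {t : ι → ι → ℝ≥0∞}
    (h : IsCouplingMatrix (fun i => ∫⁻ x, f i x ∂Q) (fun i => ∫⁻ x, f i x ∂Q') t) :
    ∀ᵐ a ∂Q, ∫⁻ b, liftDensity f (fun i => ∫⁻ x, f i x ∂Q) (fun i => ∫⁻ x, f i x ∂Q') t (a, b) ∂Q'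
      = 1 := by
  have hp := lintegral_partition_ne_top hf hQ
  have hq := lintegral_partition_ne_top hf hQ'
  have h0 : ∀ᵐ a ∂Q, ∀ i, ∫⁻ x, f i x ∂Q = 0 → f i a = 0 := by
    refine ae_all_iff.2 fun i => ?_
    by_cases hi : ∫⁻ x, f i x ∂Q = 0
    · filter_upwards [(lintegral_eq_zero_iff (hf i)).1 hi] with a ha _ using ha
    · exact Eventually.of_forall fun a h => absurd h hi
  filter_upwards [hQ, h0] with a ha h0
  simp only [liftDensity]
  rw [lintegral_finsetSum _ fun i _ => by fun_prop]
  conv_rhs => rw [← ha]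
  refine Finset.sum_congr rfl fun i _ => ?_
  rw [lintegral_finsetSum _ fun j _ => by fun_prop]
  have : ∀ j, ∫⁻ b, t i j / ((∫⁻ x, f i x ∂Q) * ∫⁻ x, f j x ∂Q') * (f i a * f j b) ∂Q'
      = t i j / (∫⁻ x, f i x ∂Q) * f i a := by
    intro j
    rw [lintegral_const_mul _ (by fun_prop), lintegral_const_mul _ (by fun_prop),
      mul_comm (f i a), ← mul_assoc, h.div_mul_mul hp hq i j]
  rw [Finset.sum_congr rfl fun j _ => this j]
  simp only [← Finset.sum_mul, div_eq_mul_inv, h.row]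
  by_cases hi : ∫⁻ x, f i x ∂Q = 0
  · simp [h0 i hi]
  · rw [ENNReal.mul_inv_cancel hi (hp i), one_mul]

lemma map_fst_prod_withDensity {F : Type*} [MeasurableSpace F] {Q : Measure E} {Q' : Measure F}
    [SFinite Q'] {W : E × F → ℝ≥0∞} (hW : Measurable W)
    (h : ∀ᵐ a ∂Q, ∫⁻ b, W (a, b) ∂Q' = 1) :
    ((Q.prod Q').withDensity W).map Prod.fst = Q := by
  refine Measure.ext_of_lintegral _ fun g hg => ?_
  rw [lintegral_map hg measurable_fst, lintegral_withDensity_eq_lintegral_mul _ hW (by fun_prop),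
    lintegral_prod _ (by fun_prop)]
  refine lintegral_congr_ae ?_
  filter_upwards [h] with a ha
  simp only [Pi.mul_apply]
  rw [lintegral_mul_const _ (by fun_prop), ha, one_mul]

lemma lift_mem_couplings [IsProbabilityMeasure Q] [IsProbabilityMeasure Q']
    (hf : ∀ i, Measurable (f i))
    (hQ : ∀ᵐ x ∂Q, ∑ i, f i x = 1) (hQ' : ∀ᵐ x ∂Q', ∑ i, f i x = 1) {t : ι → ι → ℝ≥0∞}
    (h : IsCouplingMatrix (fun i => ∫⁻ x, f i x ∂Q) (fun i => ∫⁻ x, f i x ∂Q') t) :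
    (Q.prod Q').withDensity
      (liftDensity f (fun i => ∫⁻ x, f i x ∂Q) (fun i => ∫⁻ x, f i x ∂Q') t) ∈ couplings Q Q' := by
  refine ⟨map_fst_prod_withDensity (measurable_liftDensity hf _ _ _)
    (lintegral_liftDensity_snd hf hQ hQ' h), ?_⟩
  have hs := map_fst_prod_withDensity (measurable_liftDensity hf _ _ _)
    (lintegral_liftDensity_snd hf hQ' hQ h.symm)
  conv_rhs => rw [← hs]
  refine Measure.ext_of_lintegral _ fun g hg => ?_
  rw [lintegral_map hg measurable_snd, lintegral_map hg measurable_fst,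
    lintegral_withDensity_eq_lintegral_mul _ (measurable_liftDensity hf _ _ _) (by fun_prop),
    lintegral_withDensity_eq_lintegral_mul _ (measurable_liftDensity hf _ _ _) (by fun_prop),
    ← lintegral_prod_swap]
  refine lintegral_congr fun w => ?_
  simp [liftDensity_swap]

/-- The cost of a lifted plan is at most the cost of its matrix, if `M i j` bounds the cost on the
product of the supports of `f i` and `f j`. -/
lemma planCost_lift_le [IsProbabilityMeasure Q] [IsProbabilityMeasure Q']
    (hf : ∀ i, Measurable (f i))
    (hQ : ∀ᵐ x ∂Q, ∑ i, f i x = 1) (hQ' : ∀ᵐ x ∂Q', ∑ i, f i x = 1) {t M : ι → ι → ℝ≥0∞}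
    (h : IsCouplingMatrix (fun i => ∫⁻ x, f i x ∂Q) (fun i => ∫⁻ x, f i x ∂Q') t)
    {c : E → E → ℝ} (hc : Measurable (Function.uncurry c))
    (hM : ∀ᵐ w ∂(Q.prod Q'), ∀ i j, f i w.1 ≠ 0 → f j w.2 ≠ 0 →
      ENNReal.ofReal (c w.1 w.2) ≤ M i j) :
    planCost c ((Q.prod Q').withDensity
      (liftDensity f (fun i => ∫⁻ x, f i x ∂Q) (fun i => ∫⁻ x, f i x ∂Q') t))
      ≤ ∑ i, ∑ j, t i j * M i j := by
  have hp := lintegral_partition_ne_top hf hQ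
  have hq := lintegral_partition_ne_top hf hQ'
  have hcm : Measurable fun w : E × E => ENNReal.ofReal (c w.1 w.2) := hc.ennreal_ofReal
  rw [planCost, lintegral_withDensity_eq_lintegral_mul _ (measurable_liftDensity hf _ _ _) hcm]
  calc _ ≤ ∫⁻ w, ∑ i, ∑ j, t i j / ((∫⁻ x, f i x ∂Q) * ∫⁻ x, f j x ∂Q') * M i j
            * (f i w.1 * f j w.2) ∂(Q.prod Q') := by
        refine lintegral_mono_ae ?_
        filter_upwards [hM] with w hw
        simp only [Pi.mul_apply, liftDensity, Finset.sum_mul]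
        refine Finset.sum_le_sum fun i _ => Finset.sum_le_sum fun j _ => ?_
        rw [mul_assoc (t i j / _) (M i j), mul_assoc (t i j / _), mul_comm (M i j)]
        by_cases h1 : f i w.1 = 0
        · simp [h1]
        by_cases h2 : f j w.2 = 0
        · simp [h2]
        gcongr
        exact hw i j h1 h2
    _ = ∑ i, ∑ j, t i j * M i j := by
        rw [lintegral_finsetSum _ fun i _ => by fun_prop]
        refine Finset.sum_congr rfl fun i _ => ?_
        rw [lintegral_finsetSum _ fun i _ => by fun_prop]
        refine Finset.sum_congr rfl fun j _ => ?_
        rw [lintegral_const_mul _ (by fun_prop),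
          lintegral_prod_mul (hf i).aemeasurable (hf j).aemeasurable, mul_right_comm]
        congr 1
        rw [mul_comm (∫⁻ x, f i x ∂Q) (∫⁻ x, f j x ∂Q'), ← mul_assoc, mul_comm (∫⁻ x, f j x ∂Q'),
          h.div_mul_mul hp hq i j]
        exact ENNReal.div_mul_cancel' (fun h0 => le_antisymm (h0 ▸ h.le_row i j) zero_le)
          (fun ht => absurd ht (hp i))

end Lift

/-! ### Partitions of unity adapted to a cost function -/

section CostPartition

variable {E : Type*} [TopologicalSpace E]

/-- A continuous partition of unity `f` on `K` such that the cost function `c` oscillates by at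
most `ε` on the product of the supports of any two members. The number `M i j` is an upper bound
for `c` on the product of the supports of `f i` and `f j`. -/
structure CostPartition (K : Set E) (c : E → E → ℝ) (ε : ℝ≥0∞) (n : ℕ) where
  /-- the members of the partition of unity -/
  f : Fin n → BoundedContinuousFunction E NNReal
  /-- the costs between the members -/
  M : Fin n → Fin n → ℝ≥0∞
  /-- a bound for all costs -/
  B : NNReal
  sum_eq_one : ∀ x ∈ K, ∑ i, (f i x : ℝ≥0∞) = 1
  M_le : ∀ i j, M i j ≤ B
  le_M : ∀ i j, ∀ a ∈ K, ∀ b ∈ K, f i a ≠ 0 → f j b ≠ 0 → ENNReal.ofReal (c a b) ≤ M i j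
  M_le_add : ∀ i j, ∀ a ∈ K, ∀ b ∈ K, f i a ≠ 0 → f j b ≠ 0 → M i j ≤ ENNReal.ofReal (c a b) + ε

end CostPartition

/-- Cover the compact set by finitely many balls whose radius is half a modulus of uniform
continuity of the cost. -/
lemma exists_costPartition {E : Type*} [MetricSpace E] [LocallyCompactSpace E] {K : Set E}
    (hK : IsCompact K) {c : E → E → ℝ} (hc : Continuous (Function.uncurry c)) {ε : ℝ}
    (hε : 0 < ε) : ∃ n, Nonempty (CostPartition K c (ENNReal.ofReal ε) n) := by
  obtain ⟨δ, hδ, hunif⟩ := Metric.uniformContinuousOn_iff.1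
    ((hK.prod hK).uniformContinuousOn_of_continuous hc.continuousOn) ε hε
  obtain ⟨B, hB⟩ := (hK.prod hK).bddAbove_image hc.continuousOn
  obtain ⟨s, -, hs⟩ := hK.elim_nhds_subcover (fun x => Metric.ball x (δ / 2))
    (fun x _ => Metric.ball_mem_nhds x (half_pos hδ))
  let e := s.equivFin.symm
  obtain ⟨f, hfs, hf1, hf01, -⟩ := exists_continuous_sum_one_of_isOpen_isCompact
    (s := fun i => Metric.ball (e i : E) (δ / 2)) (fun i => Metric.isOpen_ball) hK
    (by
      intro x hx
      obtain ⟨y, hy, hxy⟩ := Set.mem_iUnion₂.1 (hs hx)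
      exact Set.mem_iUnion.2 ⟨e.symm ⟨y, hy⟩, by simpa using hxy⟩)
  have hdist : ∀ i, ∀ a a' : E, f i a ≠ 0 → f i a' ≠ 0 → dist a a' < δ := by
    intro i a a' ha ha'
    have h1 : a ∈ Metric.ball (e i : E) (δ / 2) := hfs i (subset_tsupport _ ha)
    have h2 : a' ∈ Metric.ball (e i : E) (δ / 2) := hfs i (subset_tsupport _ ha')
    rw [Metric.mem_ball] at h1 h2
    linarith [dist_triangle_right a a' (e i : E)]
  have hosc : ∀ i j, ∀ a ∈ K, ∀ b ∈ K, f i a ≠ 0 → f j b ≠ 0 → ∀ a' ∈ K, ∀ b' ∈ K, f i a' ≠ 0 →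
      f j b' ≠ 0 → ENNReal.ofReal (c a' b') ≤ ENNReal.ofReal (c a b) + ENNReal.ofReal ε := by
    intro i j a ha b hb hfa hfb a' ha' b' hb' hfa' hfb'
    have h := hunif (a', b') ⟨ha', hb'⟩ (a, b) ⟨ha, hb⟩
      (max_lt (hdist i _ _ hfa' hfa) (hdist j _ _ hfb' hfb))
    simp only [Function.uncurry_apply_pair, Real.dist_eq] at h
    refine le_trans (ENNReal.ofReal_le_ofReal ?_) ENNReal.ofReal_add_le
    linarith [(abs_lt.1 h).2]
  have hne : ∀ i x, (f i x).toNNReal ≠ 0 → f i x ≠ 0 := by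
    intro i x h h0
    simp [h0] at h
  refine ⟨_, ⟨{
    f := fun i => BoundedContinuousFunction.mkOfBound
      ⟨fun x => (f i x).toNNReal, continuous_real_toNNReal.comp (f i).continuous⟩ 1 ?_
    M := fun i j => ⨆ (a ∈ K) (b ∈ K) (_ : f i a ≠ 0) (_ : f j b ≠ 0), ENNReal.ofReal (c a b)
    B := B.toNNReal
    sum_eq_one := ?_
    M_le := ?_
    le_M := ?_
    M_le_add := ?_ }⟩⟩
  · intro x y
    obtain ⟨hx0, hx1⟩ := hf01 i x
    obtain ⟨hy0, hy1⟩ := hf01 i y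
    simp only [ContinuousMap.coe_mk, NNReal.dist_eq, Real.coe_toNNReal _ hx0,
      Real.coe_toNNReal _ hy0]
    exact abs_sub_le_iff.2 ⟨by linarith, by linarith⟩
  · intro x hx
    have h := hf1 hx
    simp only [Finset.sum_apply, Pi.one_apply] at h
    change ∑ i, ENNReal.ofReal (f i x) = 1
    rw [← ENNReal.ofReal_sum_of_nonneg fun i _ => (hf01 i x).1, h, ENNReal.ofReal_one]
  · intro i j
    refine iSup₂_le fun a ha => iSup₂_le fun b hb => iSup₂_le fun _ _ => ?_
    exact ENNReal.ofReal_le_ofReal (hB ⟨(a, b), ⟨ha, hb⟩, rfl⟩)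
  · intro i j a ha b hb hfa hfb
    exact le_iSup₂_of_le a ha (le_iSup₂_of_le b hb
      (le_iSup₂_of_le (hne i a hfa) (hne j b hfb) le_rfl))
  · intro i j a ha b hb hfa hfb
    refine iSup₂_le fun a' ha' => iSup₂_le fun b' hb' => iSup₂_le fun hfa' hfb' => ?_
    exact hosc i j a ha b hb (hne i a hfa) (hne j b hfb) a' ha' b' hb' hfa' hfb'

/-! ### Stability of the optimal cost -/

section Stability

variable {E : Type*} [MetricSpace E] [MeasurableSpace E]
  {K : Set E} {c : E → E → ℝ} {ε : ℝ≥0∞} {n : ℕ}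

namespace CostPartition

/-- The weights that a measure gives to the members of the partition of unity. -/
noncomputable def weight (S : CostPartition K c ε n) (Q : Measure E) (i : Fin n) : ℝ≥0∞ :=
  ∫⁻ x, (S.f i x : ℝ≥0∞) ∂Q

/-- The masses that a plan gives to the products of members of the partition of unity. -/
noncomputable def planMatrix (S : CostPartition K c ε n) (γ : Measure (E × E)) (i j : Fin n) :
    ℝ≥0∞ :=
  ∫⁻ w, (S.f i w.1 : ℝ≥0∞) * S.f j w.2 ∂γ

/-- The density, with respect to `Q.prod Q'`, of a coupling of `Q` and `Q'` whose masses on the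
products of members of the partition of unity are close to the coupling matrix `t` of `(p, q)`. -/
noncomputable def density (S : CostPartition K c ε n) (p q : Fin n → ℝ≥0∞)
    (t : Fin n → Fin n → ℝ≥0∞) (Q Q' : Measure E) (w : E × E) : ℝ≥0∞ :=
  liftDensity (fun i x => (S.f i x : ℝ≥0∞)) (S.weight Q) (S.weight Q')
    (transferMatrix p q t (S.weight Q) (S.weight Q')) w

variable {Q Q' : Measure E}

lemma ae_sum_eq_one (S : CostPartition K c ε n) (hQ : Q Kᶜ = 0) :
    ∀ᵐ x ∂Q, ∑ i, (S.f i x : ℝ≥0∞) = 1 := by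
  filter_upwards [mem_ae_iff.2 hQ] with x hx using S.sum_eq_one x hx

variable [BorelSpace E]

lemma measurable_f (S : CostPartition K c ε n) (i : Fin n) :
    Measurable fun x => (S.f i x : ℝ≥0∞) :=
  (S.f i).continuous.measurable.coe_nnreal_ennreal

lemma sum_weight (S : CostPartition K c ε n) [IsProbabilityMeasure Q] (hQ : Q Kᶜ = 0) :
    ∑ i, S.weight Q i = 1 :=
  lintegral_partition_eq_one S.measurable_f (S.ae_sum_eq_one hQ)

lemma density_mem_couplings (S : CostPartition K c ε n) [IsProbabilityMeasure Q]
    [IsProbabilityMeasure Q'] (hQ : Q Kᶜ = 0) (hQ' : Q' Kᶜ = 0) {p q : Fin n → ℝ≥0∞}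
    {t : Fin n → Fin n → ℝ≥0∞} (h : IsCouplingMatrix p q t) :
    (Q.prod Q').withDensity (S.density p q t Q Q') ∈ couplings Q Q' :=
  lift_mem_couplings S.measurable_f (S.ae_sum_eq_one hQ) (S.ae_sum_eq_one hQ')
    (isCouplingMatrix_transferMatrix h (S.sum_weight hQ) (S.sum_weight hQ'))

lemma planCost_density_le (S : CostPartition K c ε n) (hc : Measurable (Function.uncurry c))
    [IsProbabilityMeasure Q]
    [IsProbabilityMeasure Q'] (hQ : Q Kᶜ = 0) (hQ' : Q' Kᶜ = 0) {p q : Fin n → ℝ≥0∞}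
    {t : Fin n → Fin n → ℝ≥0∞} (h : IsCouplingMatrix p q t) (hp : ∑ i, p i = 1) :
    planCost c ((Q.prod Q').withDensity (S.density p q t Q Q'))
      ≤ ∑ i, ∑ j, t i j * S.M i j
        + (∑ i, (p i - S.weight Q i) + ∑ i, (q i - S.weight Q' i)) * S.B := by
  refine (planCost_lift_le S.measurable_f (S.ae_sum_eq_one hQ) (S.ae_sum_eq_one hQ')
    (isCouplingMatrix_transferMatrix h (S.sum_weight hQ) (S.sum_weight hQ')) hc
    (M := S.M) ?_).trans
    (sum_transferMatrix_le h hp (S.sum_weight hQ) (S.sum_weight hQ') S.M_le)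
  have h1 : ∀ᵐ w ∂(Q.prod Q'), w.1 ∈ K :=
    Measure.quasiMeasurePreserving_fst.ae (mem_ae_iff.2 hQ)
  have h2 : ∀ᵐ w ∂(Q.prod Q'), w.2 ∈ K :=
    Measure.quasiMeasurePreserving_snd.ae (mem_ae_iff.2 hQ')
  filter_upwards [h1, h2] with w hw1 hw2 i j hi hj
  exact S.le_M i j _ hw1 _ hw2 (by simpa using hi) (by simpa using hj)

lemma isCouplingMatrix_planMatrix (S : CostPartition K c ε n) (hQ : Q Kᶜ = 0) (hQ' : Q' Kᶜ = 0)
    {γ : Measure (E × E)} (hγ : γ ∈ couplings Q Q') :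
    IsCouplingMatrix (S.weight Q) (S.weight Q') (S.planMatrix γ) := by
  have hf := S.measurable_f
  have h1 : ∀ᵐ w ∂γ, ∑ i, (S.f i w.1 : ℝ≥0∞) = 1 :=
    ae_of_ae_map measurable_fst.aemeasurable (hγ.1 ▸ S.ae_sum_eq_one hQ)
  have h2 : ∀ᵐ w ∂γ, ∑ i, (S.f i w.2 : ℝ≥0∞) = 1 :=
    ae_of_ae_map measurable_snd.aemeasurable (hγ.2 ▸ S.ae_sum_eq_one hQ')
  constructor
  · intro i
    simp only [planMatrix, weight]
    rw [← lintegral_finsetSum _ fun j _ => by fun_prop, ← hγ.1,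
      lintegral_map (hf i) measurable_fst]
    refine lintegral_congr_ae ?_
    filter_upwards [h2] with w hw
    rw [← Finset.mul_sum, hw, mul_one]
  · intro j
    simp only [planMatrix, weight]
    rw [← lintegral_finsetSum _ fun j _ => by fun_prop, ← hγ.2,
      lintegral_map (hf j) measurable_snd]
    refine lintegral_congr_ae ?_
    filter_upwards [h1] with w hw
    rw [← Finset.sum_mul, hw, one_mul]

/-- The matrix of a plan costs at most `ε` more than the plan, as the cost oscillates by at most `ε`
on each product of supports. -/
lemma sum_planMatrix_le (S : CostPartition K c ε n) (hc : Measurable (Function.uncurry c))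
    [IsProbabilityMeasure Q] (hQ : Q Kᶜ = 0)
    (hQ' : Q' Kᶜ = 0) {γ : Measure (E × E)} (hγ : γ ∈ couplings Q Q') :
    ∑ i, ∑ j, S.planMatrix γ i j * S.M i j ≤ planCost c γ + ε := by
  have hf := S.measurable_f
  have hK : ∀ᵐ w ∂γ, w ∈ K ×ˢ K :=
    mem_ae_iff.2 (measure_prod_compl_eq_zero_of_mem_couplings hγ hQ hQ')
  have huniv : IsProbabilityMeasure γ := isProbabilityMeasure_of_mem_couplings hγ
  have hcm : Measurable fun w : E × E => ENNReal.ofReal (c w.1 w.2) := hc.ennreal_ofReal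
  calc ∑ i, ∑ j, S.planMatrix γ i j * S.M i j
      = ∫⁻ w, ∑ i, ∑ j, (S.f i w.1 : ℝ≥0∞) * S.f j w.2 * S.M i j ∂γ := by
        rw [lintegral_finsetSum _ fun j _ => by fun_prop]
        refine Finset.sum_congr rfl fun i _ => ?_
        rw [lintegral_finsetSum _ fun j _ => by fun_prop]
        refine Finset.sum_congr rfl fun j _ => ?_
        rw [lintegral_mul_const _ (by fun_prop), planMatrix]
    _ ≤ ∫⁻ w, (ENNReal.ofReal (c w.1 w.2) + ε) ∂γ := by
        refine lintegral_mono_ae ?_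
        filter_upwards [hK] with w ⟨hw1, hw2⟩
        calc _ ≤ ∑ i, ∑ j, (S.f i w.1 : ℝ≥0∞) * S.f j w.2
                  * (ENNReal.ofReal (c w.1 w.2) + ε) := by
              refine Finset.sum_le_sum fun i _ => Finset.sum_le_sum fun j _ => ?_
              by_cases hi : S.f i w.1 = 0
              · simp [hi]
              by_cases hj : S.f j w.2 = 0
              · simp [hj]
              gcongr
              exact S.M_le_add i j _ hw1 _ hw2 hi hj
          _ = _ := by
              simp only [← Finset.sum_mul, ← Finset.mul_sum]
              rw [S.sum_eq_one _ hw1, S.sum_eq_one _ hw2, one_mul, one_mul]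
    _ = planCost c γ + ε := by
        rw [lintegral_add_left hcm, lintegral_const, measure_univ, mul_one, planCost]

end CostPartition

variable [BorelSpace E]

/-- The optimal cost between probability measures on a compact set is upper semicontinuous for
the weak topology: any plan between the limits bounds it. -/
theorem eventually_optimalCost_le [LocallyCompactSpace E] [SecondCountableTopology E]
    (hK : IsCompact K) (hc : Continuous (Function.uncurry c)) (Q Q' : ProbabilityMeasure E)
    (hQ : (Q : Measure E) Kᶜ = 0) (hQ' : (Q' : Measure E) Kᶜ = 0) {γ : Measure (E × E)}
    (hγ : γ ∈ couplings (Q : Measure E) Q') {ε : ℝ≥0∞} (hε : ε ≠ 0) :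
    ∀ᶠ R : ProbabilityMeasure E × ProbabilityMeasure E in 𝓝 (Q, Q'),
      (R.1 : Measure E) Kᶜ = 0 → (R.2 : Measure E) Kᶜ = 0 →
        optimalCost c (R.1 : Measure E) R.2 ≤ planCost c γ + ε := by
  rcases eq_or_ne ε ∞ with rfl | hε'
  · simp
  obtain ⟨n, ⟨S⟩⟩ := exists_costPartition hK hc
    (ENNReal.toReal_pos (ENNReal.half_pos hε).ne' (ENNReal.div_ne_top hε' two_ne_zero))
  rw [ENNReal.ofReal_toReal (ENNReal.div_ne_top hε' two_ne_zero)] at S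
  have hcont : ∀ i, Continuous fun R : ProbabilityMeasure E => S.weight R i := fun i =>
    ProbabilityMeasure.continuous_lintegral_boundedContinuousFunction (S.f i)
  have hfin : ∀ (R : ProbabilityMeasure E), (R : Measure E) Kᶜ = 0 → ∀ i, S.weight R i ≠ ∞ :=
    fun R hR i => lintegral_partition_ne_top S.measurable_f (S.ae_sum_eq_one hR) i
  have hlim : Tendsto (fun R : ProbabilityMeasure E × ProbabilityMeasure E =>
      (∑ i, (S.weight Q i - S.weight R.1 i) + ∑ i, (S.weight Q' i - S.weight R.2 i)) * S.B)
      (𝓝 (Q, Q')) (𝓝 ((∑ i, (S.weight Q i - S.weight Q i)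
        + ∑ i, (S.weight Q' i - S.weight Q' i)) * S.B)) := by
    refine ENNReal.Tendsto.mul_const (Tendsto.add ?_ ?_) (Or.inr ENNReal.coe_ne_top)
    · exact tendsto_finsetSum _ fun i _ => ENNReal.Tendsto.sub tendsto_const_nhds
        (((hcont i).comp continuous_fst).tendsto (Q, Q')) (Or.inl (hfin Q hQ i))
    · exact tendsto_finsetSum _ fun i _ => ENNReal.Tendsto.sub tendsto_const_nhds
        (((hcont i).comp continuous_snd).tendsto (Q, Q')) (Or.inl (hfin Q' hQ' i))
  simp only [tsub_self, Finset.sum_const_zero, add_zero, zero_mul] at hlim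
  filter_upwards [hlim.eventually (ge_mem_nhds (ENNReal.half_pos hε))] with R hR hR1 hR2
  have ht := S.isCouplingMatrix_planMatrix hQ hQ' hγ
  calc optimalCost c (R.1 : Measure E) R.2
      ≤ planCost c _ := iInf₂_le _ (S.density_mem_couplings hR1 hR2 ht)
    _ ≤ _ := S.planCost_density_le hc.measurable hR1 hR2 ht (S.sum_weight hQ)
    _ ≤ planCost c γ + ε / 2 + ε / 2 :=
        add_le_add (S.sum_planMatrix_le hc.measurable hQ hQ' hγ) hR
    _ = planCost c γ + ε := by rw [add_assoc, ENNReal.add_halves]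

end Stability

/-! ### Measurable selection of nearly optimal plans -/

section Selection

variable {E : Type*} [MetricSpace E] [MeasurableSpace E] [BorelSpace E] [LocallyCompactSpace E]
  [SecondCountableTopology E] {K : Set E} {c : E → E → ℝ} {Z : Type*} [MeasurableSpace Z]

/-- Numbers in the same cell of the grid of mesh `1 / L` differ by at most `1 / L`. -/
lemma tsub_le_inv_of_floor_eq {a b : ℝ≥0∞} (ha : a ≠ ∞) (hb : b ≠ ∞) {L : ℕ} (hL : L ≠ 0)
    (h : ⌊a.toReal * L⌋₊ = ⌊b.toReal * L⌋₊) : a - b ≤ (L : ℝ≥0∞)⁻¹ := by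
  have hL' : (0 : ℝ) < L := by positivity
  rw [tsub_le_iff_left, ← ENNReal.ofReal_toReal ha, ← ENNReal.ofReal_toReal hb,
    ← ENNReal.ofReal_natCast, ← ENNReal.ofReal_inv_of_pos hL',
    ← ENNReal.ofReal_add ENNReal.toReal_nonneg (by positivity)]
  refine ENNReal.ofReal_le_ofReal ?_
  have h1 := Nat.lt_floor_add_one (a.toReal * L)
  have h2 := Nat.floor_le (a := b.toReal * L) (by positivity)
  rw [h] at h1
  have h3 : a.toReal * L ≤ (b.toReal + (L : ℝ)⁻¹) * L := by
    rw [add_mul, inv_mul_cancel₀ hL'.ne']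
    linarith
  exact le_of_mul_le_mul_right h3 hL'

lemma prod_mem_couplings {F : Type*} [MeasurableSpace F] (Q Q' : Measure F)
    [IsProbabilityMeasure Q] [IsProbabilityMeasure Q'] :
    Q.prod Q' ∈ couplings Q Q' := ⟨by simp, by simp⟩

/-- Between the values of two kernels, plans whose cost exceeds the optimal cost by at most `δ` can
be chosen measurably, as densities with respect to the product measures. The parameter space is
cut into countably many classes on which the weights of a partition of unity are almost constant,
and one nearly optimal plan for each class is adapted to all parameters in the class. -/
theorem exists_measurable_nearly_optimal (hK : IsCompact K) (hc : Continuous (Function.uncurry c))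
    (κ₁ κ₂ : Kernel Z E) [IsMarkovKernel κ₁] [IsMarkovKernel κ₂] {δ : ℝ≥0∞} (hδ : δ ≠ 0) :
    ∃ W : Z → E × E → ℝ≥0∞, Measurable (Function.uncurry W) ∧
      ∀ z, κ₁ z Kᶜ = 0 → κ₂ z Kᶜ = 0 →
        ((κ₁ z).prod (κ₂ z)).withDensity (W z) ∈ couplings (κ₁ z) (κ₂ z) ∧
        planCost c (((κ₁ z).prod (κ₂ z)).withDensity (W z))
          ≤ optimalCost c (κ₁ z) (κ₂ z) + δ := by
  wlog hδ' : δ ≠ ∞ generalizing δ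
  · obtain ⟨W, hW, h⟩ := this one_ne_zero ENNReal.one_ne_top
    refine ⟨W, hW, fun z h1 h2 => ⟨(h z h1 h2).1, ?_⟩⟩
    rw [not_not.1 hδ']
    simp
  have h3 : δ / 3 ≠ ∞ := ENNReal.div_ne_top hδ' (by simp)
  have h3' : δ / 3 ≠ 0 := (ENNReal.div_pos hδ (by simp)).ne'
  obtain ⟨n, ⟨S⟩⟩ := exists_costPartition hK hc (ENNReal.toReal_pos h3' h3)
  rw [ENNReal.ofReal_toReal h3] at S
  obtain ⟨L, hL⟩ := ENNReal.exists_nat_gt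
    (r := ((n : ℝ≥0∞) + n) * S.B / (δ / 3))
    (ENNReal.div_ne_top (ENNReal.mul_ne_top (by simp) ENNReal.coe_ne_top) h3')
  have hL0 : L ≠ 0 := by
    rintro rfl
    simp at hL
  let code : Z → (Fin n → ℕ) × (Fin n → ℕ) := fun z =>
    (fun i => ⌊(S.weight (κ₁ z) i).toReal * L⌋₊, fun i => ⌊(S.weight (κ₂ z) i).toReal * L⌋₊)
  have hfin : ∀ (R : Measure E) [IsProbabilityMeasure R], R Kᶜ = 0 → ∀ i, S.weight R i ≠ ∞ :=
    fun R _ hR i => lintegral_partition_ne_top S.measurable_f (S.ae_sum_eq_one hR) i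
  have hw₁ : ∀ i, Measurable fun z => S.weight (κ₁ z) i :=
    fun i => (S.measurable_f i).lintegral_kernel
  have hw₂ : ∀ i, Measurable fun z => S.weight (κ₂ z) i :=
    fun i => (S.measurable_f i).lintegral_kernel
  have hcode : Measurable code := by
    refine Measurable.prodMk (measurable_pi_lambda _ fun i => ?_)
      (measurable_pi_lambda _ fun i => ?_)
    · exact Nat.measurable_floor.comp ((hw₁ i).ennreal_toReal.mul_const _)
    · exact Nat.measurable_floor.comp ((hw₂ i).ennreal_toReal.mul_const _)
  -- the matrix of one nearly optimal plan among all plans for all parameters of a class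
  have hrep : ∀ m, ∃ r : (Fin n → ℝ≥0∞) × (Fin n → ℝ≥0∞) × (Fin n → Fin n → ℝ≥0∞),
      ∀ z, code z = m → κ₁ z Kᶜ = 0 → κ₂ z Kᶜ = 0 →
        IsCouplingMatrix r.1 r.2.1 r.2.2 ∧ ∑ i, r.1 i = 1 ∧
        (∀ i, r.1 i - S.weight (κ₁ z) i ≤ (L : ℝ≥0∞)⁻¹) ∧
        (∀ i, r.2.1 i - S.weight (κ₂ z) i ≤ (L : ℝ≥0∞)⁻¹) ∧
        ∑ i, ∑ j, r.2.2 i j * S.M i j ≤ optimalCost c (κ₁ z) (κ₂ z) + δ / 3 + δ / 3 := by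
    intro m
    by_cases hm : ∃ z, code z = m ∧ κ₁ z Kᶜ = 0 ∧ κ₂ z Kᶜ = 0
    swap
    · exact ⟨0, fun z h1 h2 h3 => absurd ⟨z, h1, h2, h3⟩ hm⟩
    obtain ⟨z₁, hz₁⟩ := hm
    obtain ⟨z₀, γ, ⟨hz₀, h1, h2⟩, hγ, hle⟩ : ∃ z₀ γ, (code z₀ = m ∧ κ₁ z₀ Kᶜ = 0 ∧ κ₂ z₀ Kᶜ = 0) ∧
        γ ∈ couplings (κ₁ z₀) (κ₂ z₀) ∧ planCost c γ ≤
          (⨅ z, ⨅ (_ : code z = m ∧ κ₁ z Kᶜ = 0 ∧ κ₂ z Kᶜ = 0), optimalCost c (κ₁ z) (κ₂ z))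
            + δ / 3 := by
      rcases eq_or_ne (⨅ z, ⨅ (_ : code z = m ∧ κ₁ z Kᶜ = 0 ∧ κ₂ z Kᶜ = 0),
        optimalCost c (κ₁ z) (κ₂ z)) ∞ with htop | htop
      · exact ⟨z₁, _, hz₁, prod_mem_couplings _ _, by simp [htop]⟩
      · have hlt := ENNReal.lt_add_right htop h3'
        conv_lhs at hlt => simp only [optimalCost]
        simp only [iInf_lt_iff] at hlt
        obtain ⟨z, hz, γ, hγ, h⟩ := hlt
        exact ⟨z, γ, hz, hγ, h.le⟩
    refine ⟨(S.weight (κ₁ z₀), S.weight (κ₂ z₀), S.planMatrix γ), fun z hz h1' h2' =>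
      ⟨S.isCouplingMatrix_planMatrix h1 h2 hγ, S.sum_weight h1, fun i => ?_, fun i => ?_, ?_⟩⟩
    · exact tsub_le_inv_of_floor_eq (hfin _ h1 i) (hfin _ h1' i) hL0
        (congr_fun (congr_arg Prod.fst (hz₀.trans hz.symm)) i)
    · exact tsub_le_inv_of_floor_eq (hfin _ h2 i) (hfin _ h2' i) hL0
        (congr_fun (congr_arg Prod.snd (hz₀.trans hz.symm)) i)
    · refine (S.sum_planMatrix_le hc.measurable h1 h2 hγ).trans ?_
      gcongr
      refine hle.trans ?_
      gcongr
      exact iInf₂_le z ⟨hz, h1', h2'⟩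
  choose r hr using hrep
  have hrm : Measurable fun z => r (code z) := (Measurable.of_discrete (f := r)).comp hcode
  refine ⟨fun z => S.density (r (code z)).1 (r (code z)).2.1 (r (code z)).2.2 (κ₁ z) (κ₂ z),
    ?_, fun z h1 h2 => ?_⟩
  · have := S.measurable_f
    have hrm' : Measurable fun p : Z × E × E => r (code p.1) := hrm.comp measurable_fst
    have hr1 : ∀ i, Measurable fun p : Z × E × E => (r (code p.1)).1 i := by fun_prop
    have hr2 : ∀ i, Measurable fun p : Z × E × E => (r (code p.1)).2.1 i := by fun_prop
    have hr3 : ∀ i j, Measurable fun p : Z × E × E => (r (code p.1)).2.2 i j := by fun_prop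
    have hw₁' : ∀ i, Measurable fun p : Z × E × E => S.weight (κ₁ p.1) i :=
      fun i => (hw₁ i).comp measurable_fst
    have hw₂' : ∀ i, Measurable fun p : Z × E × E => S.weight (κ₂ p.1) i :=
      fun i => (hw₂ i).comp measurable_fst
    simp only [Function.uncurry_def, CostPartition.density, liftDensity, transferMatrix,
      keptMatrix]
    fun_prop
  · obtain ⟨hmat, hsum, hp, hq, hcost⟩ := hr _ z rfl h1 h2
    refine ⟨S.density_mem_couplings h1 h2 hmat,
      (S.planCost_density_le hc.measurable h1 h2 hmat hsum).trans ?_⟩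
    have hloss : (∑ i, ((r (code z)).1 i - S.weight (κ₁ z) i)
        + ∑ i, ((r (code z)).2.1 i - S.weight (κ₂ z) i)) * S.B ≤ δ / 3 := by
      calc _ ≤ (∑ _ : Fin n, (L : ℝ≥0∞)⁻¹ + ∑ _ : Fin n, (L : ℝ≥0∞)⁻¹) * S.B := by
            gcongr with i _ i _
            · exact hp i
            · exact hq i
        _ = ((n : ℝ≥0∞) + n) * S.B / L := by
            simp only [Finset.sum_const, Finset.card_univ, Fintype.card_fin, nsmul_eq_mul,
              div_eq_mul_inv]
            ring
        _ ≤ δ / 3 := by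
            refine ENNReal.div_le_of_le_mul ?_
            exact ((ENNReal.div_le_iff h3' h3).1 hL.le).trans_eq (mul_comm _ _)
    calc _ ≤ optimalCost c (κ₁ z) (κ₂ z) + δ / 3 + δ / 3 + δ / 3 := add_le_add hcost hloss
      _ = _ := by rw [add_assoc, add_assoc, ← add_assoc (δ / 3), ENNReal.add_thirds]

/-- If the plans `κ z` between `κ₁ z` and `κ₂ z` have, in the mean, the least cost among all
measurable families of plans that are absolutely continuous with respect to the product measures,
then almost all of them are optimal. -/
theorem ae_planCost_eq_optimalCost (hK : IsCompact K) (hc : Continuous (Function.uncurry c))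
    (κ₁ κ₂ : Kernel Z E) [IsMarkovKernel κ₁] [IsMarkovKernel κ₂] (κ : Kernel Z (E × E))
    {ν : Measure Z} [IsProbabilityMeasure ν]
    (h₁ : ∀ᵐ z ∂ν, κ₁ z Kᶜ = 0) (h₂ : ∀ᵐ z ∂ν, κ₂ z Kᶜ = 0)
    (hκ : ∀ᵐ z ∂ν, κ z ∈ couplings (κ₁ z) (κ₂ z))
    (hfin : ∫⁻ z, planCost c (κ z) ∂ν ≠ ∞)
    (hmin : ∀ W : Z → E × E → ℝ≥0∞, Measurable (Function.uncurry W) →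
      (∀ᵐ z ∂ν, ((κ₁ z).prod (κ₂ z)).withDensity (W z) ∈ couplings (κ₁ z) (κ₂ z)) →
      ∫⁻ z, planCost c (κ z) ∂ν
        ≤ ∫⁻ z, planCost c (((κ₁ z).prod (κ₂ z)).withDensity (W z)) ∂ν) :
    ∀ᵐ z ∂ν, planCost c (κ z) = optimalCost c (κ₁ z) (κ₂ z) := by
  have hcm : Measurable fun w : E × E => ENNReal.ofReal (c w.1 w.2) := hc.measurable.ennreal_ofReal
  choose W hWm hW using fun n : ℕ => exists_measurable_nearly_optimal hK hc κ₁ κ₂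
    (δ := (n : ℝ≥0∞)⁻¹) (by simp)
  let g : ℕ → Z → ℝ≥0∞ := fun n z => planCost c (((κ₁ z).prod (κ₂ z)).withDensity (W n z))
  have hg : ∀ n, Measurable (g n) := by
    intro n
    have hWn : ∀ z, Measurable (W n z) := fun z => (hWm n).comp measurable_prodMk_left
    have : g n = fun z => ∫⁻ w, W n z w * ENNReal.ofReal (c w.1 w.2) ∂((κ₁ ×ₖ κ₂) z) := by
      funext z
      simp only [g, planCost, Kernel.prod_apply]
      rw [lintegral_withDensity_eq_lintegral_mul _ (hWn z) hcm]
      rfl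
    rw [this]
    refine Measurable.lintegral_kernel_prod_right' (κ := κ₁ ×ₖ κ₂)
      (f := fun p : Z × E × E => W n p.1 p.2 * ENNReal.ofReal (c p.2.1 p.2.2)) ?_
    exact (hWm n).mul (hcm.comp measurable_snd)
  -- a measurable lower bound of the optimal cost that is attained in the mean
  let h : Z → ℝ≥0∞ := fun z => ⨆ n : ℕ, (g n z - (n : ℝ≥0∞)⁻¹)
  have hh : Measurable h := Measurable.iSup fun n => (hg n).sub_const _
  have hle : ∀ᵐ z ∂ν, h z ≤ optimalCost c (κ₁ z) (κ₂ z) := by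
    filter_upwards [h₁, h₂] with z hz1 hz2
    exact iSup_le fun n => tsub_le_iff_right.2 (hW n z hz1 hz2).2
  have hle' : ∀ᵐ z ∂ν, optimalCost c (κ₁ z) (κ₂ z) ≤ planCost c (κ z) := by
    filter_upwards [hκ] with z hz using iInf₂_le _ hz
  have hint : ∫⁻ z, planCost c (κ z) ∂ν ≤ ∫⁻ z, h z ∂ν := by
    refine ge_of_tendsto (f := fun n : ℕ => ∫⁻ z, h z ∂ν + (n : ℝ≥0∞)⁻¹) (x := atTop) ?_
      (Eventually.of_forall fun n => ?_)
    · simpa using tendsto_const_nhds.add ENNReal.tendsto_inv_nat_nhds_zero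
    · calc ∫⁻ z, planCost c (κ z) ∂ν ≤ ∫⁻ z, g n z ∂ν := by
            refine hmin (W n) (hWm n) ?_
            filter_upwards [h₁, h₂] with z hz1 hz2 using (hW n z hz1 hz2).1
        _ ≤ ∫⁻ z, (h z + (n : ℝ≥0∞)⁻¹) ∂ν := by
            refine lintegral_mono fun z => ?_
            exact tsub_le_iff_right.1 (le_iSup (fun n : ℕ => g n z - (n : ℝ≥0∞)⁻¹) n)
        _ = _ := by rw [lintegral_add_left hh, lintegral_const, measure_univ, mul_one]
  have hmeas : Measurable fun z => planCost c (κ z) := hcm.lintegral_kernel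
  have hae : h =ᵐ[ν] fun z => planCost c (κ z) := by
    refine ae_eq_of_ae_le_of_lintegral_le ?_ (ne_top_of_le_ne_top hfin ?_) hmeas.aemeasurable hint
    · filter_upwards [hle, hle'] with z hz hz' using hz.trans hz'
    · refine lintegral_mono_ae ?_
      filter_upwards [hle, hle'] with z hz hz' using hz.trans hz'
  filter_upwards [hle, hle', hae] with z hz hz' hz''
  exact le_antisymm (hz''.symm.trans_le hz) hz'

end Selection

/-! ### Plans over the diagonal of the condition space -/

section FourPlans

variable {dx dc : ℕ}

lemma continuous_sqDist (n : ℕ) :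
    Continuous (Function.uncurry (sqDist : EuclideanSpace ℝ (Fin n) → _ → ℝ)) := by
  unfold sqDist Function.uncurry
  fun_prop

lemma continuous_augCost (β : ℝ) :
    Continuous (Function.uncurry (augCost β : Aug dx dc → Aug dx dc → ℝ)) := by
  unfold augCost sqDist Function.uncurry
  fun_prop

lemma continuous_augPairCost :
    Continuous (Function.uncurry
      (augPairCost : Aug dx dc × Aug dx dc → Aug dx dc × Aug dx dc → ℝ)) := by
  unfold augPairCost augCost sqDist Function.uncurry
  fun_prop

lemma measurable_ofReal_sqDist (n : ℕ) : Measurable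
    fun w : EuclideanSpace ℝ (Fin n) × EuclideanSpace ℝ (Fin n) =>
      ENNReal.ofReal (sqDist w.1 w.2) :=
  (continuous_sqDist n).measurable.ennreal_ofReal

lemma measurable_ofReal_augCost (β : ℝ) :
    Measurable fun w : Aug dx dc × Aug dx dc => ENNReal.ofReal (augCost β w.1 w.2) :=
  (continuous_augCost β).measurable.ennreal_ofReal

lemma sqDist_self {n : ℕ} (x : EuclideanSpace ℝ (Fin n)) : sqDist x x = 0 := by simp [sqDist]

lemma sqDist_nonneg {n : ℕ} (x y : EuclideanSpace ℝ (Fin n)) : 0 ≤ sqDist x y := sq_nonneg _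

lemma augCost_of_eq {β : ℝ} {p q : Aug dx dc} (h : p.2 = q.2) :
    augCost β p q = sqDist p.1 q.1 := by
  simp [augCost, h, sqDist_self]

variable {P : Measure (EuclideanSpace ℝ (Fin dx) × EuclideanSpace ℝ (Fin dc))}
  {Γ : Measure (Aug dx dc × Aug dx dc)}

/-- A plan whose marginal on the pair of conditions sits on the diagonal couples only points with
equal conditions. -/
lemma ae_eq_of_mem_fourPlans {ν : Measure (CondPair dc)} {Q R : Measure (Aug dx dc)}
    (h : Γ ∈ fourPlans ν Q R) : ∀ᵐ w ∂Γ, w.1.2 = w.2.2 := by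
  have hd : MeasurableSet {z : CondPair dc × CondPair dc | z.1 = z.2} := measurableSet_diagonal
  have h1 : ∀ᵐ z ∂(Γ.map fun w => (w.1.2, w.2.2)), z.1 = z.2 := by
    rw [h.2]
    exact (ae_map_iff (by fun_prop) hd).2 (Eventually.of_forall fun z => rfl)
  exact ae_of_ae_map (by fun_prop) h1

/-- On plans over the diagonal the condition part of the cost has no weight. -/
lemma planCost_augCost_of_mem_fourPlans {ν : Measure (CondPair dc)} {Q R : Measure (Aug dx dc)}
    (h : Γ ∈ fourPlans ν Q R) (β : ℝ) :
    planCost (augCost β) Γ = ∫⁻ w, ENNReal.ofReal (sqDist w.1.1 w.2.1) ∂Γ := by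
  refine lintegral_congr_ae ?_
  filter_upwards [ae_eq_of_mem_fourPlans h] with w hw
  rw [augCost_of_eq hw]

lemma threePlan_map_fst (h : Γ ∈ fourPlans (condLaw P) (augLaw₁ P) (augLaw₂ P)) :
    (threePlan Γ).map (fun p => (p.2.1, p.1)) = augLaw₁ P := by
  rw [threePlan, Measure.map_map (by fun_prop) (by fun_prop), ← h.1.1]
  rfl

lemma threePlan_map_snd (h : Γ ∈ fourPlans (condLaw P) (augLaw₁ P) (augLaw₂ P)) :
    (threePlan Γ).map (fun p => (p.2.2, p.1)) = augLaw₂ P := by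
  rw [threePlan, Measure.map_map (by fun_prop) (by fun_prop), ← h.1.2]
  refine Measure.map_congr ?_
  filter_upwards [ae_eq_of_mem_fourPlans h] with w hw
  simp [hw]

lemma augLaw₁_map_snd [IsProbabilityMeasure P] : (augLaw₁ P).map Prod.snd = condLaw P := by
  rw [augLaw₁, condLaw, Measure.map_map (by fun_prop) (by fun_prop),
    Measure.map_prod_map _ _ (by fun_prop) (by fun_prop)]
  rfl

/-- The plan over the diagonal that is given by the joint law of `z` and `(x₁, x₂)`; it inverts
`threePlan`. -/
noncomputable def diagPlan
    (T : Measure (CondPair dc × (EuclideanSpace ℝ (Fin dx) × EuclideanSpace ℝ (Fin dx)))) :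
    Measure (Aug dx dc × Aug dx dc) :=
  T.map fun p => ((p.2.1, p.1), (p.2.2, p.1))

lemma diagPlan_mem_fourPlans [IsProbabilityMeasure P]
    {T : Measure (CondPair dc × (EuclideanSpace ℝ (Fin dx) × EuclideanSpace ℝ (Fin dx)))}
    (h₁ : T.map (fun p => (p.2.1, p.1)) = augLaw₁ P)
    (h₂ : T.map (fun p => (p.2.2, p.1)) = augLaw₂ P) :
    diagPlan T ∈ fourPlans (condLaw P) (augLaw₁ P) (augLaw₂ P) := by
  refine ⟨⟨?_, ?_⟩, ?_⟩
  · rw [← h₁, diagPlan, Measure.map_map (by fun_prop) (by fun_prop)]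
    rfl
  · rw [← h₂, diagPlan, Measure.map_map (by fun_prop) (by fun_prop)]
    rfl
  · rw [← augLaw₁_map_snd, ← h₁, diagPlan, Measure.map_map (by fun_prop) (by fun_prop),
      Measure.map_map (by fun_prop) (by fun_prop), Measure.map_map (by fun_prop) (by fun_prop)]
    rfl

lemma planCost_diagPlan
    (T : Measure (CondPair dc × (EuclideanSpace ℝ (Fin dx) × EuclideanSpace ℝ (Fin dx))))
    (β : ℝ) :
    planCost (augCost β) (diagPlan T) = ∫⁻ p, ENNReal.ofReal (sqDist p.2.1 p.2.2) ∂T := by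
  rw [planCost, diagPlan, lintegral_map (measurable_ofReal_augCost β) (by fun_prop)]
  refine lintegral_congr fun p => ?_
  rw [augCost_of_eq (p := (p.2.1, p.1)) (q := (p.2.2, p.1)) rfl]

/-- The plan that couples the observations independently given the conditions has finite cost. -/
lemma condW2Sq_ne_top [IsProbabilityMeasure P] {X : Set (EuclideanSpace ℝ (Fin dx))}
    (hX : IsCompact X) (hPX : ∀ᵐ p ∂P, p.1 ∈ X) :
    condW2Sq (condLaw P) (augLaw₁ P) (augLaw₂ P) ≠ ∞ := by
  let T : Measure (CondPair dc × (EuclideanSpace ℝ (Fin dx) × EuclideanSpace ℝ (Fin dx))) :=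
    (P.prod P).map fun p => ((p.1.2, p.2.2), (p.1.1, p.2.1))
  have hT : diagPlan T ∈ fourPlans (condLaw P) (augLaw₁ P) (augLaw₂ P) := by
    refine diagPlan_mem_fourPlans ?_ ?_
    · rw [Measure.map_map (by fun_prop) (by fun_prop)]
      rfl
    · rw [Measure.map_map (by fun_prop) (by fun_prop)]
      rfl
  obtain ⟨B, hB⟩ := (hX.prod hX).bddAbove_image (continuous_sqDist dx).continuousOn
  refine ne_top_of_le_ne_top (ENNReal.ofReal_ne_top (r := B)) ((iInf₂_le _ hT).trans ?_)
  have hm : Measurable fun p : CondPair dc × (EuclideanSpace ℝ (Fin dx) ×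
      EuclideanSpace ℝ (Fin dx)) => ENNReal.ofReal (sqDist p.2.1 p.2.2) :=
    (measurable_ofReal_sqDist dx).comp measurable_snd
  rw [planCost_diagPlan, lintegral_map hm (by fun_prop)]
  calc _ ≤ ∫⁻ _, ENNReal.ofReal B ∂(P.prod P) := by
        refine lintegral_mono_ae ?_
        filter_upwards [Measure.quasiMeasurePreserving_fst.ae hPX,
          Measure.quasiMeasurePreserving_snd.ae hPX] with p h1 h2
        exact ENNReal.ofReal_le_ofReal (hB ⟨(p.1.1, p.2.1), ⟨h1, h2⟩, rfl⟩)
    _ = ENNReal.ofReal B := by simp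

end FourPlans

/-! ### Disintegration of the population laws -/

/-- The fibres of a measure on a product, if the measure is disintegrated over its first factor,
have the marginals that the measure prescribes. -/
lemma ae_map_eq_of_map_compProd_eq {Z E F : Type*} [MeasurableSpace Z] [MeasurableSpace E]
    [MeasurableSpace F] [MeasurableSpace.CountableOrCountablyGenerated Z F] {ν : Measure Z}
    [IsFiniteMeasure ν] {κ : Kernel Z E} [IsMarkovKernel κ] {η : Kernel Z F} [IsMarkovKernel η]
    {f : E → F} (hf : Measurable f)
    (h : (ν ⊗ₘ κ).map (fun p => (f p.2, p.1)) = (ν ⊗ₘ η).map Prod.swap) :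
    ∀ᵐ z ∂ν, (κ z).map f = η z := by
  have hkey : ν ⊗ₘ (κ.map f) = ν ⊗ₘ η := by
    refine Measure.ext_of_lintegral _ fun g hg => ?_
    have : ∫⁻ p, g p.swap ∂((ν ⊗ₘ κ).map (fun p => (f p.2, p.1)))
        = ∫⁻ p, g p.swap ∂((ν ⊗ₘ η).map Prod.swap) := by rw [h]
    rw [lintegral_map (by fun_prop) (by fun_prop), lintegral_map (by fun_prop) (by fun_prop),
      Measure.lintegral_compProd (by fun_prop)] at this
    simp only [Prod.swap_swap] at this
    rw [← this, Measure.lintegral_compProd (by fun_prop)]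
    refine lintegral_congr fun z => ?_
    rw [Kernel.map_apply _ hf, lintegral_map (by fun_prop) hf]
    rfl
  have := Kernel.IsMarkovKernel.map κ hf
  filter_upwards [Kernel.ae_eq_of_compProd_eq hkey] with z hz
  rw [← hz, Kernel.map_apply _ hf]

section Disintegration

variable {dx dc : ℕ} {P : Measure (EuclideanSpace ℝ (Fin dx) × EuclideanSpace ℝ (Fin dc))}
  [IsProbabilityMeasure P]
  {Pc : Kernel (EuclideanSpace ℝ (Fin dc)) (EuclideanSpace ℝ (Fin dx))} [IsMarkovKernel Pc]
  [(P.map Prod.swap).IsCondKernel Pc]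

instance : IsProbabilityMeasure (condLaw P) := by
  have : IsProbabilityMeasure (P.map Prod.snd) :=
    Measure.isProbabilityMeasure_map measurable_snd.aemeasurable
  unfold condLaw
  infer_instance

lemma lintegral_eq_lintegral_condKernel
    (Pc : Kernel (EuclideanSpace ℝ (Fin dc)) (EuclideanSpace ℝ (Fin dx))) [IsMarkovKernel Pc]
    [(P.map Prod.swap).IsCondKernel Pc]
    {g : EuclideanSpace ℝ (Fin dx) × EuclideanSpace ℝ (Fin dc) → ℝ≥0∞} (hg : Measurable g) :
    ∫⁻ p, g p ∂P = ∫⁻ c, ∫⁻ x, g (x, c) ∂(Pc c) ∂(P.map Prod.snd) := by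
  have hfst : (P.map Prod.swap).fst = P.map Prod.snd := Measure.fst_map_swap
  calc ∫⁻ p, g p ∂P = ∫⁻ p, g p.swap ∂(P.map Prod.swap) := by
        rw [lintegral_map (by fun_prop) measurable_swap]
        simp
    _ = _ := by
        conv_lhs => rw [← (P.map Prod.swap).disintegrate Pc]
        rw [Measure.lintegral_compProd (by fun_prop), hfst]
        rfl

/-- The law of two independent draws, disintegrated over the pair of their conditions. -/
lemma lintegral_prod_eq_lintegral_condKernel
    (Pc : Kernel (EuclideanSpace ℝ (Fin dc)) (EuclideanSpace ℝ (Fin dx))) [IsMarkovKernel Pc]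
    [(P.map Prod.swap).IsCondKernel Pc]
    {g : (EuclideanSpace ℝ (Fin dx) × EuclideanSpace ℝ (Fin dc)) ×
      (EuclideanSpace ℝ (Fin dx) × EuclideanSpace ℝ (Fin dc)) → ℝ≥0∞} (hg : Measurable g) :
    ∫⁻ p, g p ∂(P.prod P) = ∫⁻ z, ∫⁻ w, g ((w.1, z.1), (w.2, z.2)) ∂((Pc z.1).prod (Pc z.2))
      ∂(condLaw P) := by
  have hP : IsProbabilityMeasure (P.map Prod.snd) :=
    Measure.isProbabilityMeasure_map measurable_snd.aemeasurable
  have hk : Measurable fun p : ((EuclideanSpace ℝ (Fin dc) × EuclideanSpace ℝ (Fin dc)) ×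
      EuclideanSpace ℝ (Fin dx)) => ∫⁻ x₂, g ((p.2, p.1.1), (x₂, p.1.2)) ∂(Pc p.1.2) := by
    have := Measurable.lintegral_kernel_prod_right' (κ := Pc.comap
      (fun p : ((EuclideanSpace ℝ (Fin dc) × EuclideanSpace ℝ (Fin dc)) ×
        EuclideanSpace ℝ (Fin dx)) => p.1.2) (by fun_prop))
      (f := fun q => g ((q.1.2, q.1.1.1), (q.2, q.1.1.2))) (by fun_prop)
    simpa using this
  rw [lintegral_prod _ hg.aemeasurable,
    lintegral_eq_lintegral_condKernel Pc hg.lintegral_prod_right',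
    condLaw, lintegral_prod]
  · refine lintegral_congr fun c₁ => ?_
    have h1 : ∀ x₁, ∫⁻ q, g ((x₁, c₁), q) ∂P
        = ∫⁻ c₂, ∫⁻ x₂, g ((x₁, c₁), (x₂, c₂)) ∂(Pc c₂) ∂(P.map Prod.snd) := fun x₁ =>
      lintegral_eq_lintegral_condKernel Pc (by fun_prop)
    simp only [h1]
    rw [lintegral_lintegral_swap]
    · refine lintegral_congr fun c₂ => ?_
      rw [lintegral_prod _ (by fun_prop)]
    · have hmap : Measurable fun p : EuclideanSpace ℝ (Fin dx) × EuclideanSpace ℝ (Fin dc) =>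
        ((c₁, p.2), p.1) := by fun_prop
      exact (hk.comp hmap).aemeasurable
  · have hm : Measurable fun z : CondPair dc =>
        ∫⁻ x₁, ∫⁻ x₂, g ((x₁, z.1), (x₂, z.2)) ∂(Pc z.2) ∂(Pc z.1) := by
      have := Measurable.lintegral_kernel_prod_right' (κ := Pc.comap
        (Prod.fst : CondPair dc → EuclideanSpace ℝ (Fin dc)) measurable_fst) hk
      simpa using this
    refine hm.aemeasurable.congr (Eventually.of_forall fun z => ?_)
    simp only
    rw [lintegral_prod _ (by fun_prop)]

lemma ae_condKernel_compl_eq_zero {X : Set (EuclideanSpace ℝ (Fin dx))} (hX : MeasurableSet X)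
    (hPX : ∀ᵐ p ∂P, p.1 ∈ X) : ∀ᵐ c ∂(P.map Prod.snd), Pc c Xᶜ = 0 := by
  have hm : Measurable fun p : EuclideanSpace ℝ (Fin dx) × EuclideanSpace ℝ (Fin dc) =>
      Xᶜ.indicator (1 : EuclideanSpace ℝ (Fin dx) → ℝ≥0∞) p.1 :=
    (measurable_one.indicator hX.compl).comp measurable_fst
  have h : ∫⁻ p, Xᶜ.indicator 1 p.1 ∂P = (0 : ℝ≥0∞) := by
    rw [lintegral_eq_zero_iff hm]
    filter_upwards [hPX] with p hp
    simp [hp]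
  rw [lintegral_eq_lintegral_condKernel Pc hm] at h
  simp only [lintegral_indicator_one hX.compl] at h
  exact (lintegral_eq_zero_iff (Kernel.measurable_coe Pc hX.compl)).1 h

lemma map_compProd_eq_augLaw₁ : ((condLaw P) ⊗ₘ (Pc.comap Prod.fst measurable_fst)).map Prod.swap
    = augLaw₁ P := by
  refine Measure.ext_of_lintegral _ fun g hg => ?_
  rw [lintegral_map hg (by fun_prop), Measure.lintegral_compProd (by fun_prop), augLaw₁,
    lintegral_map hg (by fun_prop), lintegral_prod_eq_lintegral_condKernel Pc (by fun_prop)]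
  refine lintegral_congr fun z => ?_
  rw [lintegral_prod _ (by fun_prop)]
  simp

lemma map_compProd_eq_augLaw₂ : ((condLaw P) ⊗ₘ (Pc.comap Prod.snd measurable_snd)).map Prod.swap
    = augLaw₂ P := by
  refine Measure.ext_of_lintegral _ fun g hg => ?_
  rw [lintegral_map hg (by fun_prop), Measure.lintegral_compProd (by fun_prop), augLaw₂,
    lintegral_map hg (by fun_prop), lintegral_prod_eq_lintegral_condKernel Pc (by fun_prop)]
  refine lintegral_congr fun z => ?_
  rw [lintegral_prod _ (by fun_prop)]
  simp

variable {Γ : Measure (Aug dx dc × Aug dx dc)}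

lemma threePlan_fst (h : Γ ∈ fourPlans (condLaw P) (augLaw₁ P) (augLaw₂ P)) :
    (threePlan Γ).fst = condLaw P := by
  rw [threePlan, Measure.fst, Measure.map_map (by fun_prop) (by fun_prop), ← augLaw₁_map_snd,
    ← h.1.1, Measure.map_map (by fun_prop) (by fun_prop)]
  rfl

/-- Every disintegration of a plan over the diagonal consists of couplings of the conditional
laws, by the uniqueness of the disintegration of the two augmented laws. -/
lemma ae_mem_couplings_of_threePlan (h : Γ ∈ fourPlans (condLaw P) (augLaw₁ P) (augLaw₂ P))
    (κ : Kernel (CondPair dc) (EuclideanSpace ℝ (Fin dx) × EuclideanSpace ℝ (Fin dx)))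
    [IsMarkovKernel κ] (hκ : (condLaw P) ⊗ₘ κ = threePlan Γ) :
    ∀ᵐ z ∂(condLaw P), κ z ∈ couplings (Pc z.1) (Pc z.2) := by
  have h1 := ae_map_eq_of_map_compProd_eq (κ := κ) (η := Pc.comap Prod.fst measurable_fst)
    measurable_fst (by rw [hκ, threePlan_map_fst h, map_compProd_eq_augLaw₁])
  have h2 := ae_map_eq_of_map_compProd_eq (κ := κ) (η := Pc.comap Prod.snd measurable_snd)
    measurable_snd (by rw [hκ, threePlan_map_snd h, map_compProd_eq_augLaw₂])
  filter_upwards [h1, h2] with z hz1 hz2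
  exact ⟨hz1, hz2⟩

lemma planCost_eq_lintegral_fibres (h : Γ ∈ fourPlans (condLaw P) (augLaw₁ P) (augLaw₂ P))
    (κ : Kernel (CondPair dc) (EuclideanSpace ℝ (Fin dx) × EuclideanSpace ℝ (Fin dx)))
    [IsMarkovKernel κ] (hκ : (condLaw P) ⊗ₘ κ = threePlan Γ) :
    planCost (augCost 1) Γ = ∫⁻ z, planCost sqDist (κ z) ∂(condLaw P) := by
  have hm : Measurable fun p : CondPair dc × (EuclideanSpace ℝ (Fin dx) ×
      EuclideanSpace ℝ (Fin dx)) => ENNReal.ofReal (sqDist p.2.1 p.2.2) :=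
    (measurable_ofReal_sqDist dx).comp measurable_snd
  calc planCost (augCost 1) Γ = ∫⁻ w, ENNReal.ofReal (sqDist w.1.1 w.2.1) ∂Γ :=
        planCost_augCost_of_mem_fourPlans h 1
    _ = ∫⁻ p, ENNReal.ofReal (sqDist p.2.1 p.2.2) ∂(threePlan Γ) := by
        rw [threePlan, lintegral_map hm (by fun_prop)]
    _ = _ := by
        rw [← hκ, Measure.lintegral_compProd hm]
        rfl

/-- A measurable family of plans between the conditional laws, given by densities, bounds the
conditional Wasserstein distance. -/
lemma condW2Sq_le_lintegral_withDensity
    {W : CondPair dc → EuclideanSpace ℝ (Fin dx) × EuclideanSpace ℝ (Fin dx) → ℝ≥0∞}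
    (hW : Measurable (Function.uncurry W))
    (hmem : ∀ᵐ z ∂(condLaw P), ((Pc z.1).prod (Pc z.2)).withDensity (W z)
      ∈ couplings (Pc z.1) (Pc z.2)) :
    condW2Sq (condLaw P) (augLaw₁ P) (augLaw₂ P)
      ≤ ∫⁻ z, planCost sqDist (((Pc z.1).prod (Pc z.2)).withDensity (W z)) ∂(condLaw P) := by
  let κ₁ : Kernel (CondPair dc) (EuclideanSpace ℝ (Fin dx)) := Pc.comap Prod.fst measurable_fst
  let κ₂ : Kernel (CondPair dc) (EuclideanSpace ℝ (Fin dx)) := Pc.comap Prod.snd measurable_snd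
  let T := ((condLaw P) ⊗ₘ (κ₁ ×ₖ κ₂)).withDensity (Function.uncurry W)
  have hWz : ∀ z, Measurable (W z) := fun z => hW.comp measurable_prodMk_left
  have hT : ∀ g : CondPair dc × (EuclideanSpace ℝ (Fin dx) × EuclideanSpace ℝ (Fin dx)) → ℝ≥0∞,
      Measurable g → ∫⁻ p, g p ∂T = ∫⁻ z, ∫⁻ w, g (z, w)
        ∂(((Pc z.1).prod (Pc z.2)).withDensity (W z)) ∂(condLaw P) := by
    intro g hg
    rw [lintegral_withDensity_eq_lintegral_mul _ hW hg, Measure.lintegral_compProd (hW.mul hg)]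
    refine lintegral_congr fun z => ?_
    rw [lintegral_withDensity_eq_lintegral_mul _ (hWz z) (by fun_prop), Kernel.prod_apply]
    rfl
  have h1 : T.map (fun p => (p.2.1, p.1)) = augLaw₁ P := by
    rw [← map_compProd_eq_augLaw₁ (Pc := Pc)]
    refine Measure.ext_of_lintegral _ fun g hg => ?_
    rw [lintegral_map hg (by fun_prop), lintegral_map hg (by fun_prop), hT _ (by fun_prop),
      Measure.lintegral_compProd (by fun_prop)]
    refine lintegral_congr_ae ?_
    filter_upwards [hmem] with z hz
    simp only [Prod.swap_prod_mk, Kernel.comap_apply]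
    conv_rhs => rw [← hz.1, lintegral_map (by fun_prop) (by fun_prop)]
  have h2 : T.map (fun p => (p.2.2, p.1)) = augLaw₂ P := by
    rw [← map_compProd_eq_augLaw₂ (Pc := Pc)]
    refine Measure.ext_of_lintegral _ fun g hg => ?_
    rw [lintegral_map hg (by fun_prop), lintegral_map hg (by fun_prop), hT _ (by fun_prop),
      Measure.lintegral_compProd (by fun_prop)]
    refine lintegral_congr_ae ?_
    filter_upwards [hmem] with z hz
    simp only [Prod.swap_prod_mk, Kernel.comap_apply]
    conv_rhs => rw [← hz.2, lintegral_map (by fun_prop) (by fun_prop)]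
  refine (iInf₂_le _ (diagPlan_mem_fourPlans h1 h2)).trans_eq ?_
  rw [planCost_diagPlan, hT]
  · rfl
  · exact (measurable_ofReal_sqDist dx).comp measurable_snd

/-- The fibres of an optimal plan for the conditional Wasserstein distance are optimal plans
between the conditional laws. -/
theorem ae_isOptimalPlan_of_isCondOptimalPlan {X : Set (EuclideanSpace ℝ (Fin dx))}
    (hX : IsCompact X) (hPX : ∀ᵐ p ∂P, p.1 ∈ X)
    (h : IsCondOptimalPlan (condLaw P) (augLaw₁ P) (augLaw₂ P) Γ)
    (κ : Kernel (CondPair dc) (EuclideanSpace ℝ (Fin dx) × EuclideanSpace ℝ (Fin dx)))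
    [IsMarkovKernel κ] [(threePlan Γ).IsCondKernel κ] :
    ∀ᵐ z ∂(condLaw P), IsOptimalPlan sqDist (Pc z.1) (Pc z.2) (κ z) := by
  have hκ : (condLaw P) ⊗ₘ κ = threePlan Γ := by
    rw [← threePlan_fst h.1, (threePlan Γ).disintegrate κ]
  have hmem := ae_mem_couplings_of_threePlan (Pc := Pc) h.1 κ hκ
  have hcost := planCost_eq_lintegral_fibres h.1 κ hκ
  have hP : IsProbabilityMeasure (P.map Prod.snd) :=
    Measure.isProbabilityMeasure_map measurable_snd.aemeasurable
  have hsupp := ae_condKernel_compl_eq_zero (Pc := Pc) hX.measurableSet hPX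
  have hopt := ae_planCost_eq_optimalCost hX (continuous_sqDist dx)
    (Pc.comap (Prod.fst : CondPair dc → _) measurable_fst)
    (Pc.comap (Prod.snd : CondPair dc → _) measurable_snd) κ (ν := condLaw P)
    (Measure.quasiMeasurePreserving_fst.ae hsupp) (Measure.quasiMeasurePreserving_snd.ae hsupp)
    hmem (by rw [← hcost, h.2]; exact condW2Sq_ne_top hX hPX)
    (fun W hW hWm => by
      rw [← hcost, h.2]
      exact condW2Sq_le_lintegral_withDensity hW hWm)
  filter_upwards [hmem, hopt] with z h1 h2 using ⟨h1, h2⟩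

end Disintegration

/-! ### Optimal permutations are optimal plans -/

section Birkhoff

variable {A : Type*} [MeasurableSpace A] {N : ℕ}

lemma lintegral_empirical [MeasurableSingletonClass A] (a : Fin N → A) (g : A → ℝ≥0∞) :
    ∫⁻ x, g x ∂(empirical a) = (N : ℝ≥0∞)⁻¹ * ∑ i, g (a i) := by
  simp [empirical]

lemma map_empirical {B : Type*} [MeasurableSpace B] (a : Fin N → A) {g : A → B}
    (hg : Measurable g) : (empirical a).map g = empirical (g ∘ a) := by
  refine Measure.ext_of_lintegral _ fun h hh => ?_
  rw [lintegral_map hh hg]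
  have h1 : ∀ x, ∫⁻ y, h (g y) ∂(Measure.dirac x) = h (g x) :=
    fun x => lintegral_dirac' x (hh.comp hg)
  simp [empirical, lintegral_dirac' _ hh, h1]

lemma ae_empirical [MeasurableSingletonClass A] {a : Fin N → A} {p : A → Prop}
    (h : ∀ i, p (a i)) : ∀ᵐ x ∂(empirical a), p x := by
  rw [ae_iff]
  simp [empirical, h]

lemma empirical_comp_perm (a : Fin N → A) (σ : Equiv.Perm (Fin N)) :
    empirical (a ∘ σ) = empirical a := by
  simp only [empirical, Function.comp_apply]
  rw [Equiv.sum_comp σ fun i => Measure.dirac (a i)]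

lemma isProbabilityMeasure_empirical (hN : 0 < N) (a : Fin N → A) :
    IsProbabilityMeasure (empirical a) := by
  constructor
  simp only [empirical, Measure.smul_apply, Measure.finsetSum_apply, measure_univ, smul_eq_mul]
  simp only [Finset.sum_const, Finset.card_univ, Fintype.card_fin, nsmul_eq_mul, mul_one]
  exact ENNReal.inv_mul_cancel (by simpa using hN.ne') (by simp)

/-- A sum over the distinct values of `b` as a sum over all indices. -/
lemma sum_div_card_fiber {ι B : Type*} [Fintype ι] [DecidableEq B] (b : ι → B) (F : B → ℝ) :
    ∑ j, F (b j) / (Finset.univ.filter fun l => b l = b j).card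
      = ∑ v ∈ Finset.univ.image b, F v := by
  symm
  refine Finset.sum_image' _ fun i _ => ?_
  have : ∀ j ∈ Finset.univ.filter (fun l => b l = b i),
      F (b j) / (Finset.univ.filter fun l => b l = b j).card
        = F (b i) / (Finset.univ.filter fun l => b l = b i).card := by
    intro j hj
    rw [(Finset.mem_filter.1 hj).2]
  rw [Finset.sum_congr rfl this, Finset.sum_const, nsmul_eq_mul, mul_div_cancel₀]
  have : 0 < (Finset.univ.filter fun l => b l = b i).card :=
    Finset.card_pos.2 ⟨i, by simp⟩
  positivity

lemma empirical_real_singleton [MeasurableSingletonClass A] [DecidableEq A] (a : Fin N → A)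
    (u : A) : (empirical a).real {u} = (Finset.univ.filter fun l => a l = u).card / N := by
  rw [measureReal_def, ← lintegral_indicator_one (measurableSet_singleton u),
    lintegral_empirical]
  simp only [Set.indicator_apply, Set.mem_singleton_iff, Pi.one_apply, Finset.sum_boole]
  simp [ENNReal.toReal_mul, div_eq_inv_mul]

lemma mem_couplings_swap {μ ν : Measure A} {γ : Measure (A × A)} (h : γ ∈ couplings μ ν) :
    γ.map Prod.swap ∈ couplings ν μ := by
  refine ⟨?_, ?_⟩
  · rw [Measure.map_map measurable_fst measurable_swap, ← h.2]
    rfl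
  · rw [Measure.map_map measurable_snd measurable_swap, ← h.1]
    rfl

lemma sum_real_coupling_row [MeasurableSingletonClass A] [DecidableEq A]
    {a b : Fin N → A} {γ : Measure (A × A)} [IsFiniteMeasure γ]
    (hγ : γ ∈ couplings (empirical a) (empirical b))
    (u : A) : ∑ v ∈ Finset.univ.image b, γ.real {(u, v)} = (empirical a).real {u} := by
  have h1 : ∑ v ∈ Finset.univ.image b, γ.real {(u, v)}
      = γ.real (({u} ×ˢ Finset.univ.image b : Finset (A × A)) : Set (A × A)) := by
    rw [← sum_measureReal_singleton, Finset.sum_product, Finset.sum_singleton]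
  have hb : ∀ᵐ w ∂γ, w.2 ∈ Finset.univ.image b := by
    refine ae_of_ae_map (p := fun v => v ∈ Finset.univ.image b) measurable_snd.aemeasurable ?_
    rw [hγ.2]
    exact ae_empirical fun i => Finset.mem_image_of_mem b (Finset.mem_univ i)
  rw [h1, ← hγ.1, map_measureReal_apply measurable_fst (measurableSet_singleton u)]
  refine measureReal_congr ?_
  filter_upwards [hb] with w hw
  change (w ∈ (({u} ×ˢ Finset.univ.image b : Finset (A × A)) : Set (A × A)))
    = (w ∈ Prod.fst ⁻¹' {u})
  simp only [Finset.mem_coe, Finset.mem_product, Finset.mem_singleton, hw, and_true,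
    Set.mem_preimage, Set.mem_singleton_iff]

lemma sum_real_coupling_col [MeasurableSingletonClass A] [DecidableEq A]
    {a b : Fin N → A} {γ : Measure (A × A)} [IsFiniteMeasure γ]
    (hγ : γ ∈ couplings (empirical a) (empirical b))
    (v : A) : ∑ u ∈ Finset.univ.image a, γ.real {(u, v)} = (empirical b).real {v} := by
  rw [← sum_real_coupling_row (mem_couplings_swap hγ)]
  refine Finset.sum_congr rfl fun u _ => ?_
  rw [map_measureReal_apply measurable_swap (measurableSet_singleton _)]
  congr 1
  ext w
  simp [Prod.ext_iff, and_comm]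

/-- By the Birkhoff theorem, every plan between two empirical distributions costs at least as much
as some permutation: with `m i` and `n j` the multiplicities of `a i` and `b j`, the matrix
`N * γ {(a i, b j)} / (m i * n j)` is doubly stochastic. -/
theorem exists_perm_le_planCost [MeasurableSingletonClass A] (hN : 0 < N) {a b : Fin N → A}
    {c : A → A → ℝ} (hc : ∀ x y, 0 ≤ c x y) {γ : Measure (A × A)}
    (hγ : γ ∈ couplings (empirical a) (empirical b)) :
    ∃ σ : Equiv.Perm (Fin N),
      (N : ℝ≥0∞)⁻¹ * ENNReal.ofReal (∑ i, c (a i) (b (σ i))) ≤ planCost c γ := by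
  classical
  have : IsProbabilityMeasure γ := by
    have := isProbabilityMeasure_empirical hN a
    exact isProbabilityMeasure_of_mem_couplings hγ
  let m : A → ℝ := fun u => (Finset.univ.filter fun l => a l = u).card
  let n : A → ℝ := fun u => (Finset.univ.filter fun l => b l = u).card
  have hm : ∀ i, 0 < m (a i) := fun i => by
    have : 0 < (Finset.univ.filter fun l => a l = a i).card := Finset.card_pos.2 ⟨i, by simp⟩
    simp only [m]; positivity
  have hn : ∀ i, 0 < n (b i) := fun i => by
    have : 0 < (Finset.univ.filter fun l => b l = b i).card := Finset.card_pos.2 ⟨i, by simp⟩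
    simp only [n]; positivity
  have hN' : (0 : ℝ) < N := by positivity
  let D : Matrix (Fin N) (Fin N) ℝ := fun i j =>
    N * γ.real {(a i, b j)} / m (a i) / n (b j)
  have hD : D ∈ doublyStochastic ℝ (Fin N) := by
    rw [mem_doublyStochastic_iff_sum]
    refine ⟨fun i j => ?_, fun i => ?_, fun j => ?_⟩
    · have := hm i
      have := hn j
      simp only [D]; positivity
    · simp only [D, n]
      rw [sum_div_card_fiber b fun v => N * γ.real {(a i, v)} / m (a i), ← Finset.sum_div,
        ← Finset.mul_sum, sum_real_coupling_row hγ, empirical_real_singleton]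
      have := hm i
      simp only [m] at this ⊢
      field_simp
    · have hcol : ∑ i, D i j = ∑ i, (N * γ.real {(a i, b j)} / n (b j)) / m (a i) :=
        Finset.sum_congr rfl fun i _ => div_right_comm _ _ _
      simp only [m] at hcol
      rw [hcol, sum_div_card_fiber a fun v => N * γ.real {(v, b j)} / n (b j), ← Finset.sum_div,
        ← Finset.mul_sum, sum_real_coupling_col hγ, empirical_real_singleton]
      have := hn j
      simp only [n] at this ⊢
      field_simp
  obtain ⟨w, hw0, hw1, hw⟩ := exists_eq_sum_perm_of_mem_doublyStochastic hD
  have hcost : ENNReal.ofReal (∑ u ∈ Finset.univ.image a, ∑ v ∈ Finset.univ.image b,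
      c u v * γ.real {(u, v)}) ≤ planCost c γ := by
    rw [← Finset.sum_product', ENNReal.ofReal_sum_of_nonneg fun p _ =>
      mul_nonneg (hc _ _) measureReal_nonneg]
    refine le_trans (le_of_eq ?_) (setLIntegral_le_lintegral
      ((Finset.univ.image a ×ˢ Finset.univ.image b : Finset (A × A)) : Set (A × A)) _)
    rw [lintegral_finset]
    refine Finset.sum_congr rfl fun p _ => ?_
    rw [ENNReal.ofReal_mul (hc _ _), ofReal_measureReal]
  have hsum : ∑ i, ∑ j, D i j * c (a i) (b j) = N * ∑ u ∈ Finset.univ.image a,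
      ∑ v ∈ Finset.univ.image b, c u v * γ.real {(u, v)} := by
    calc ∑ i, ∑ j, D i j * c (a i) (b j)
        = ∑ i, ∑ j, (N * (c (a i) (b j) * γ.real {(a i, b j)}) / m (a i)) / n (b j) := by
          refine Finset.sum_congr rfl fun i _ => Finset.sum_congr rfl fun j _ => ?_
          simp only [D]
          ring
      _ = ∑ i, (∑ v ∈ Finset.univ.image b, N * (c (a i) v * γ.real {(a i, v)})) / m (a i) := by
          refine Finset.sum_congr rfl fun i _ => ?_
          rw [Finset.sum_div]
          exact sum_div_card_fiber b fun v => N * (c (a i) v * γ.real {(a i, v)}) / m (a i)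
      _ = ∑ u ∈ Finset.univ.image a, ∑ v ∈ Finset.univ.image b,
            N * (c u v * γ.real {(u, v)}) :=
          sum_div_card_fiber a fun u => ∑ v ∈ Finset.univ.image b, N * (c u v * γ.real {(u, v)})
      _ = _ := by simp only [Finset.mul_sum]
  have hsum' : ∑ i, ∑ j, D i j * c (a i) (b j) = ∑ σ, w σ * ∑ i, c (a i) (b (σ i)) := by
    simp only [← hw, Matrix.sum_apply, Matrix.smul_apply, smul_eq_mul, Finset.sum_mul]
    simp only [Finset.mul_sum]
    conv_lhs => enter [2, i]; rw [Finset.sum_comm]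
    rw [Finset.sum_comm]
    refine Finset.sum_congr rfl fun σ _ => Finset.sum_congr rfl fun i _ => ?_
    simp [Equiv.Perm.permMatrix, PEquiv.toMatrix_apply, Equiv.toPEquiv_apply]
  obtain ⟨σ, -, hσ⟩ := Finset.exists_min_image Finset.univ
    (fun σ : Equiv.Perm (Fin N) => ∑ i, c (a i) (b (σ i))) ⟨1, Finset.mem_univ _⟩
  refine ⟨σ, le_trans ?_ hcost⟩
  rw [← ENNReal.ofReal_natCast, ← ENNReal.ofReal_inv_of_pos hN',
    ← ENNReal.ofReal_mul (by positivity)]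
  refine ENNReal.ofReal_le_ofReal ?_
  rw [inv_mul_le_iff₀ hN', ← hsum, hsum']
  calc ∑ i, c (a i) (b (σ i)) = ∑ τ, w τ * ∑ i, c (a i) (b (σ i)) := by
        rw [← Finset.sum_mul, hw1, one_mul]
    _ ≤ _ := Finset.sum_le_sum fun τ _ =>
        mul_le_mul_of_nonneg_left (hσ τ (Finset.mem_univ _)) (hw0 τ)

end Birkhoff

section EmpiricalPlan

variable {dx dc N : ℕ} {D₁ D₂ : ℕ → EuclideanSpace ℝ (Fin dx) × EuclideanSpace ℝ (Fin dc)}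

instance : MeasurableSingletonClass (Aug dx dc × Aug dx dc) := Prod.instMeasurableSingletonClass

lemma augCost_nonneg {β : ℝ} (hβ : 0 ≤ β) (p q : Aug dx dc) : 0 ≤ augCost β p q :=
  add_nonneg (sqDist_nonneg _ _)
    (mul_nonneg hβ (add_nonneg (sqDist_nonneg _ _) (sqDist_nonneg _ _)))

lemma planCost_permPlan {β : ℝ} (hβ : 0 ≤ β) (π : Equiv.Perm (Fin N)) :
    planCost (augCost β) (permPlan N D₁ D₂ π)
      = (N : ℝ≥0∞)⁻¹ * ENNReal.ofReal (∑ i, augCost β (augData₁ N D₁ D₂ i)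
          (augData₂ N D₁ D₂ (π i))) := by
  rw [planCost, permPlan, lintegral_empirical,
    ENNReal.ofReal_sum_of_nonneg fun i _ => augCost_nonneg hβ _ _]

/-- An empirical optimal coupling is an optimal plan, also when it comes from a permutation. -/
theorem IsEmpiricalOptimal.isOptimalPlan (hN : 0 < N) {β : ℝ} (hβ : 0 ≤ β)
    {γ : Measure (Aug dx dc × Aug dx dc)} (h : IsEmpiricalOptimal N D₁ D₂ β γ) :
    IsOptimalPlan (augCost β) (empirical (augData₁ N D₁ D₂)) (empirical (augData₂ N D₁ D₂)) γ := by
  rcases h with ⟨π, hπ, rfl⟩ | h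
  swap
  · exact h
  have hmem : permPlan N D₁ D₂ π
      ∈ couplings (empirical (augData₁ N D₁ D₂)) (empirical (augData₂ N D₁ D₂)) := by
    refine ⟨map_empirical _ measurable_fst, ?_⟩
    rw [permPlan, map_empirical _ measurable_snd, ← empirical_comp_perm (augData₂ N D₁ D₂) π]
    rfl
  refine ⟨hmem, le_antisymm (le_iInf₂ fun γ hγ => ?_) (iInf₂_le _ hmem)⟩
  obtain ⟨σ, hσ⟩ := exists_perm_le_planCost hN (augCost_nonneg hβ) hγ
  refine le_trans ?_ hσ
  rw [planCost_permPlan hβ]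
  exact mul_le_mul_right (ENNReal.ofReal_le_ofReal (hπ σ)) _

end EmpiricalPlan

/-! ### Weak convergence of empirical distributions in probability -/

section EmpiricalConvergence

variable {E Ω : Type*} [MeasurableSpace Ω] {μ : Measure Ω}

/-- If the integrals of bounded continuous functions converge in probability to the integrals
against `Q`, then every weak neighbourhood of `Q` has probability tending to one. The sets whose
probability tends to one form a filter, and the hypothesis says that this filter converges
weakly to `Q`. -/
lemma tendsto_measure_notMem_of_forall_integral [TopologicalSpace E] [MeasurableSpace E]
    [OpensMeasurableSpace E] {e : ℕ → Ω → ProbabilityMeasure E} {Q : ProbabilityMeasure E}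
    (h : ∀ f : BoundedContinuousFunction E ℝ, ∀ ε > 0, Tendsto (fun n => μ {ω | ε ≤
      dist (∫ x, f x ∂(e n ω : Measure E)) (∫ x, f x ∂(Q : Measure E))}) atTop (𝓝 0))
    {U : Set (ProbabilityMeasure E)} (hU : U ∈ 𝓝 Q) :
    Tendsto (fun n => μ {ω | e n ω ∉ U}) atTop (𝓝 0) := by
  let F : Filter (ProbabilityMeasure E) :=
    { sets := {U | Tendsto (fun n => μ {ω | e n ω ∉ U}) atTop (𝓝 0)}
      univ_sets := by simp
      sets_of_superset := fun {U V} hU hUV =>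
        tendsto_of_tendsto_of_tendsto_of_le_of_le tendsto_const_nhds hU (fun _ => zero_le)
          fun n => measure_mono fun ω hω hω' => hω (hUV hω')
      inter_sets := fun {U V} hU hV => by
        have hUV := Tendsto.add (Set.mem_ofPred.1 hU) (Set.mem_ofPred.1 hV)
        rw [add_zero] at hUV
        refine tendsto_of_tendsto_of_tendsto_of_le_of_le tendsto_const_nhds hUV
          (fun _ => zero_le) fun n => le_trans (measure_mono fun ω hω => ?_) (measure_union_le _ _)
        by_contra hcon
        simp only [Set.mem_union, Set.mem_ofPred_eq, not_or, not_not] at hcon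
        exact hω hcon }
  have hF : F ≤ 𝓝 Q := by
    refine (ProbabilityMeasure.tendsto_iff_forall_integral_tendsto (F := F) (μs := id)).2
      fun f => ?_
    refine Metric.tendsto_nhds.2 fun ε hε => ?_
    change Tendsto (fun n => μ {ω | e n ω ∉ {R : ProbabilityMeasure E |
      dist (∫ x, f x ∂(R : Measure E)) (∫ x, f x ∂(Q : Measure E)) < ε}}) atTop (𝓝 0)
    simpa using h f ε hε
  exact hF hU

variable [MeasurableSpace E]

/-- The empirical distribution of the first `n + 1` terms of a sequence. -/
noncomputable def empiricalPM (n : ℕ) (a : ℕ → E) : ProbabilityMeasure E :=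
  ⟨empirical fun i : Fin (n + 1) => a i, isProbabilityMeasure_empirical n.succ_pos _⟩

lemma integral_empiricalPM [TopologicalSpace E] [OpensMeasurableSpace E] (n : ℕ) (a : ℕ → E)
    (f : BoundedContinuousFunction E ℝ) :
    ∫ x, f x ∂(empiricalPM n a : Measure E)
      = (∑ i ∈ Finset.range (n + 1), f (a i)) / ((n + 1 : ℕ) : ℝ) := by
  have hf : StronglyMeasurable f := f.continuous.measurable.stronglyMeasurable
  change ∫ x, f x ∂(empirical fun i : Fin (n + 1) => a i) = _
  rw [empirical, integral_smul_measure, integral_finsetSum_measure fun i _ => f.integrable _]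
  simp only [integral_dirac' _ _ hf, ENNReal.toReal_inv, ENNReal.toReal_natCast, smul_eq_mul]
  rw [Fin.sum_univ_eq_sum_range (fun i => f (a i)), inv_mul_eq_div]

/-- The empirical distributions of pairwise independent, identically distributed points converge
weakly in probability to the law of the points. -/
theorem tendsto_measure_empiricalPM_notMem [IsProbabilityMeasure μ] [TopologicalSpace E]
    [OpensMeasurableSpace E]
    {Y : ℕ → Ω → E} {Q : ProbabilityMeasure E} (hY : ∀ i, HasLaw (Y i) (Q : Measure E) μ)
    (hind : Pairwise fun i j => IndepFun (Y i) (Y j) μ)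
    {U : Set (ProbabilityMeasure E)} (hU : U ∈ 𝓝 Q) :
    Tendsto (fun n => μ {ω | empiricalPM n (fun i => Y i ω) ∉ U}) atTop (𝓝 0) := by
  refine tendsto_measure_notMem_of_forall_integral (fun f ε hε => ?_) hU
  have hf : Measurable f := f.continuous.measurable
  have hident : ∀ i, IdentDistrib (fun ω => f (Y i ω)) (fun ω => f (Y 0 ω)) μ μ := fun i =>
    (IdentDistrib.mk (hY i).aemeasurable (hY 0).aemeasurable
      ((hY i).map_eq.trans (hY 0).map_eq.symm)).comp hf
  have hmeas : ∀ i, AEMeasurable (fun ω => f (Y i ω)) μ := fun i =>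
    hf.comp_aemeasurable (hY i).aemeasurable
  have hint : Integrable (fun ω => f (Y 0 ω)) μ :=
    Integrable.of_bound (hmeas 0).aestronglyMeasurable ‖f‖
      (Eventually.of_forall fun ω => f.norm_coe_le_norm _)
  have hlaw := strong_law_ae_real (fun i ω => f (Y i ω)) hint
    (fun i j hij => (hind hij).comp hf hf) hident
  have hmean : μ[fun ω => f (Y 0 ω)] = ∫ x, f x ∂(Q : Measure E) := by
    rw [← (hY 0).map_eq, integral_map (hY 0).aemeasurable hf.aestronglyMeasurable]
  have hprob := tendstoInMeasure_of_tendsto_ae (fun n => ?_) hlaw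
  · have h := (tendstoInMeasure_iff_dist.1 hprob ε hε).comp (tendsto_add_atTop_nat 1)
    refine h.congr fun n => ?_
    simp only [Function.comp_apply, integral_empiricalPM]
    rw [hmean]
  · exact ((Finset.aemeasurable_fun_sum _ fun i _ => hmeas i).div_const _).aestronglyMeasurable

/-- If, for every `k`, the probability of `B k n` tends to zero with `n`, then indices `n k` can be
chosen such that almost surely only finitely many of the events `B k (n k)` occur. -/
lemma exists_strictMono_ae_eventually_notMem {B : ℕ → ℕ → Set Ω}
    (hB : ∀ k, Tendsto (fun n => μ (B k n)) atTop (𝓝 0)) :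
    ∃ n : ℕ → ℕ, StrictMono n ∧ ∀ᵐ ω ∂μ, ∀ᶠ k in atTop, ω ∉ B k (n k) := by
  obtain ⟨ε, hε, hsum⟩ := ENNReal.exists_pos_sum_of_countable' (one_ne_zero (α := ℝ≥0∞)) ℕ
  obtain ⟨n, hn, h⟩ := extraction_forall_of_eventually fun k =>
    (hB k).eventually (ge_mem_nhds (hε k))
  refine ⟨n, hn, ae_eventually_notMem ?_⟩
  exact ne_top_of_le_ne_top (ne_top_of_lt hsum) (ENNReal.tsum_le_tsum h)

end EmpiricalConvergence

/-! ### Limits of almost optimal plans with growing weight on the conditions -/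

section Limit

variable {dx dc : ℕ}

/-- The cost of a continuous nonnegative cost function is lower semicontinuous for the weak
topology. -/
lemma planCost_le_of_tendsto {A : Type*} [TopologicalSpace (A × A)] [MeasurableSpace A]
    [OpensMeasurableSpace (A × A)] [HasOuterApproxClosed (A × A)]
    {c : A → A → ℝ} (hc : Continuous (Function.uncurry c)) (hc0 : ∀ x y, 0 ≤ c x y)
    {g : ℕ → ProbabilityMeasure (A × A)} {Γ : ProbabilityMeasure (A × A)}
    (hg : Tendsto g atTop (𝓝 Γ)) {V : ℝ≥0∞} {b : ℕ → ℝ≥0∞} (hb : Tendsto b atTop (𝓝 V))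
    (h : ∀ᶠ k in atTop, planCost c (g k : Measure (A × A)) ≤ b k) :
    planCost c (Γ : Measure (A × A)) ≤ V := by
  have hlsc := lintegral_le_liminf_lintegral_of_forall_isOpen_measure_le_liminf_measure
    (μ := (Γ : Measure (A × A))) (μs := fun k => (g k : Measure (A × A))) hc
    (fun w => hc0 w.1 w.2) (fun G hG => ?_)
  · exact hlsc.trans ((liminf_le_liminf h).trans_eq hb.liminf_eq)
  · exact ProbabilityMeasure.le_liminf_measure_open_of_tendsto hg hG

/-- On probability measures carried by a compact set, weak convergence implies that the optimal
cost to the limit tends to zero. -/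
lemma tendsto_optimalCost_of_tendsto {E : Type*} [MetricSpace E] [MeasurableSpace E] [BorelSpace E]
    [LocallyCompactSpace E] [SecondCountableTopology E] {K : Set E} (hK : IsCompact K)
    {c : E → E → ℝ} (hc : Continuous (Function.uncurry c)) (hc0 : ∀ x, c x x = 0)
    {g : ℕ → ProbabilityMeasure E} {Γ : ProbabilityMeasure E} (hg : Tendsto g atTop (𝓝 Γ))
    (hgK : ∀ k, (g k : Measure E) Kᶜ = 0) (hΓK : (Γ : Measure E) Kᶜ = 0) :
    Tendsto (fun k => optimalCost c (g k : Measure E) (Γ : Measure E)) atTop (𝓝 0) := by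
  have hcm : Measurable fun w : E × E => ENNReal.ofReal (c w.1 w.2) := hc.measurable.ennreal_ofReal
  have hdm : Measurable fun x : E => (x, x) := by fun_prop
  have hdiag : (Γ : Measure E).map (fun x => (x, x)) ∈ couplings (Γ : Measure E) Γ := by
    refine ⟨?_, ?_⟩
    · rw [Measure.map_map measurable_fst hdm]
      exact Measure.map_id
    · rw [Measure.map_map measurable_snd hdm]
      exact Measure.map_id
  have hcost : planCost c ((Γ : Measure E).map (fun x => (x, x))) = 0 := by
    rw [planCost, lintegral_map hcm hdm]
    simp [hc0]
  refine ENNReal.tendsto_nhds_zero.2 fun ε hε => ?_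
  have h := eventually_optimalCost_le hK hc Γ Γ hΓK hΓK hdiag hε.ne'
  rw [hcost, zero_add] at h
  filter_upwards [(hg.prodMk_nhds tendsto_const_nhds).eventually h] with k hk
  exact hk (hgK k) hΓK

lemma tendsto_planW2_of_tendsto {K : Set (Aug dx dc × Aug dx dc)} (hK : IsCompact K)
    {g : ℕ → ProbabilityMeasure (Aug dx dc × Aug dx dc)}
    {Γ : ProbabilityMeasure (Aug dx dc × Aug dx dc)} (hg : Tendsto g atTop (𝓝 Γ))
    (hgK : ∀ k, (g k : Measure (Aug dx dc × Aug dx dc)) Kᶜ = 0)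
    (hΓK : (Γ : Measure (Aug dx dc × Aug dx dc)) Kᶜ = 0) :
    Tendsto (fun k => planW2 (g k : Measure (Aug dx dc × Aug dx dc))
      (Γ : Measure (Aug dx dc × Aug dx dc))) atTop (𝓝 0) := by
  have hopt := tendsto_optimalCost_of_tendsto hK continuous_augPairCost
    (fun w => by simp [augPairCost, augCost, sqDist_self]) hg hgK hΓK
  have := (ENNReal.continuous_rpow_const (y := (1 / 2 : ℝ))).tendsto 0
  rw [ENNReal.zero_rpow_of_pos (by norm_num)] at this
  exact this.comp hopt

/-- A plan between the population laws whose cost stays bounded when the weight of the conditions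
grows is carried by the diagonal, and is optimal for the conditional Wasserstein distance if the
bound is the value of that distance. -/
lemma isCondOptimalPlan_of_forall_planCost_le
    {P : Measure (EuclideanSpace ℝ (Fin dx) × EuclideanSpace ℝ (Fin dc))} [IsProbabilityMeasure P]
    (hfin : condW2Sq (condLaw P) (augLaw₁ P) (augLaw₂ P) ≠ ∞)
    {Γ : Measure (Aug dx dc × Aug dx dc)} (hΓ : Γ ∈ couplings (augLaw₁ P) (augLaw₂ P))
    (h : ∀ b : ℝ, 0 ≤ b →
      planCost (augCost b) Γ ≤ condW2Sq (condLaw P) (augLaw₁ P) (augLaw₂ P)) :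
    IsCondOptimalPlan (condLaw P) (augLaw₁ P) (augLaw₂ P) Γ := by
  set V := condW2Sq (condLaw P) (augLaw₁ P) (augLaw₂ P)
  let d : Aug dx dc × Aug dx dc → ℝ := fun w => sqDist w.1.2.1 w.2.2.1 + sqDist w.1.2.2 w.2.2.2
  have hd0 : ∀ w, 0 ≤ d w := fun w => add_nonneg (sqDist_nonneg _ _) (sqDist_nonneg _ _)
  have hdm : Measurable fun w => ENNReal.ofReal (d w) := by
    have : Continuous d := by
      simp only [d, sqDist]
      fun_prop
    exact this.measurable.ennreal_ofReal
  have hmul : ∀ n : ℕ, n * ∫⁻ w, ENNReal.ofReal (d w) ∂Γ ≤ V := by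
    intro n
    refine le_trans ?_ (h n n.cast_nonneg)
    rw [← lintegral_const_mul _ hdm]
    refine lintegral_mono fun w => ?_
    rw [← ENNReal.ofReal_natCast, ← ENNReal.ofReal_mul n.cast_nonneg]
    refine ENNReal.ofReal_le_ofReal ?_
    simp only [augCost, d]
    linarith [sqDist_nonneg w.1.1 w.2.1]
  have hzero : ∫⁻ w, ENNReal.ofReal (d w) ∂Γ = 0 := by
    by_contra hne
    obtain ⟨n, hn⟩ := ENNReal.exists_nat_mul_gt hne hfin
    exact absurd (hmul n) (not_le.2 hn)
  have heq : ∀ᵐ w ∂Γ, w.1.2 = w.2.2 := by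
    filter_upwards [(lintegral_eq_zero_iff hdm).1 hzero] with w hw
    have hdw : d w ≤ 0 := ENNReal.ofReal_eq_zero.1 hw
    have h1 : sqDist w.1.2.1 w.2.2.1 = 0 := by
      simp only [d] at hdw
      linarith [sqDist_nonneg w.1.2.1 w.2.2.1, sqDist_nonneg w.1.2.2 w.2.2.2]
    have h2 : sqDist w.1.2.2 w.2.2.2 = 0 := by
      simp only [d] at hdw
      linarith [sqDist_nonneg w.1.2.1 w.2.2.1, sqDist_nonneg w.1.2.2 w.2.2.2]
    refine Prod.ext ?_ ?_
    · exact sub_eq_zero.1 (norm_eq_zero.1 (pow_eq_zero_iff two_ne_zero |>.1 h1))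
    · exact sub_eq_zero.1 (norm_eq_zero.1 (pow_eq_zero_iff two_ne_zero |>.1 h2))
  have hmem : Γ ∈ fourPlans (condLaw P) (augLaw₁ P) (augLaw₂ P) := by
    refine ⟨hΓ, ?_⟩
    rw [← augLaw₁_map_snd, ← hΓ.1, Measure.map_map (by fun_prop) (by fun_prop),
      Measure.map_map (by fun_prop) (by fun_prop)]
    refine Measure.map_congr ?_
    filter_upwards [heq] with w hw
    simp [hw]
  exact ⟨hmem, le_antisymm (h 1 zero_le_one) (iInf₂_le _ hmem)⟩

/-- Plans between approximations of the population laws, whose costs for growing weights on the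
conditions asymptotically do not exceed the conditional Wasserstein distance, subconverge to
optimal plans. -/
theorem exists_subseq_tendsto_isCondOptimalPlan
    {P : Measure (EuclideanSpace ℝ (Fin dx) × EuclideanSpace ℝ (Fin dc))} [IsProbabilityMeasure P]
    (hfin : condW2Sq (condLaw P) (augLaw₁ P) (augLaw₂ P) ≠ ∞)
    {Q₁ Q₂ : ProbabilityMeasure (Aug dx dc)} (hQ₁ : (Q₁ : Measure (Aug dx dc)) = augLaw₁ P)
    (hQ₂ : (Q₂ : Measure (Aug dx dc)) = augLaw₂ P) {K : Set (Aug dx dc)} (hK : IsCompact K)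
    (hQ₁K : (Q₁ : Measure (Aug dx dc)) Kᶜ = 0) (hQ₂K : (Q₂ : Measure (Aug dx dc)) Kᶜ = 0)
    {e₁ e₂ : ℕ → ProbabilityMeasure (Aug dx dc)} (he₁ : Tendsto e₁ atTop (𝓝 Q₁))
    (he₂ : Tendsto e₂ atTop (𝓝 Q₂)) (he₁K : ∀ k, (e₁ k : Measure (Aug dx dc)) Kᶜ = 0)
    (he₂K : ∀ k, (e₂ k : Measure (Aug dx dc)) Kᶜ = 0)
    {β : ℕ → ℝ} (hβ : Tendsto β atTop atTop) {γ : ℕ → Measure (Aug dx dc × Aug dx dc)}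
    (hγ : ∀ k, γ k ∈ couplings (e₁ k : Measure (Aug dx dc)) (e₂ k)) {b : ℕ → ℝ≥0∞}
    (hb : Tendsto b atTop (𝓝 (condW2Sq (condLaw P) (augLaw₁ P) (augLaw₂ P))))
    (hcost : ∀ᶠ k in atTop, planCost (augCost (β k)) (γ k) ≤ b k) :
    ∃ ψ : ℕ → ℕ, StrictMono ψ ∧ ∃ Γ : Measure (Aug dx dc × Aug dx dc),
      IsCondOptimalPlan (condLaw P) (augLaw₁ P) (augLaw₂ P) Γ ∧
      Tendsto (fun j => planW2 (γ (ψ j)) Γ) atTop (𝓝 0) := by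
  have hprob : ∀ k, IsProbabilityMeasure (γ k) :=
    fun k => isProbabilityMeasure_of_mem_couplings (hγ k)
  let g : ℕ → ProbabilityMeasure (Aug dx dc × Aug dx dc) := fun k => ⟨γ k, hprob k⟩
  have hgK : ∀ k, (g k : Measure (Aug dx dc × Aug dx dc)) (K ×ˢ K)ᶜ = 0 := fun k =>
    measure_prod_compl_eq_zero_of_mem_couplings (hγ k) (he₁K k) (he₂K k)
  have hcomp : IsCompact (closure (Set.range g)) := by
    refine isCompact_closure_of_isTightMeasureSet
      (isTightMeasureSet_iff_exists_isCompact_measure_compl_le.2 fun ε _ =>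
        ⟨K ×ˢ K, hK.prod hK, ?_⟩)
    rintro _ ⟨_, ⟨k, rfl⟩, rfl⟩
    rw [hgK k]
    exact zero_le
  obtain ⟨Γ, -, ψ, hψ, hlim⟩ := hcomp.tendsto_subseq fun k => subset_closure (Set.mem_range_self k)
  have hfst : (Γ : Measure (Aug dx dc × Aug dx dc)).map Prod.fst = augLaw₁ P := by
    have h1 := ProbabilityMeasure.tendsto_map_of_tendsto_of_continuous _ _ hlim
      (f := Prod.fst) continuous_fst
    have h2 : Tendsto (fun j => e₁ (ψ j)) atTop (𝓝 Q₁) := he₁.comp hψ.tendsto_atTop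
    have h3 : (fun j => ((g ∘ ψ) j).map (f := Prod.fst) continuous_fst.measurable.aemeasurable)
        = fun j => e₁ (ψ j) := by
      funext j
      exact Subtype.ext (hγ (ψ j)).1
    rw [h3] at h1
    rw [← hQ₁, ← tendsto_nhds_unique h1 h2]
    rfl
  have hsnd : (Γ : Measure (Aug dx dc × Aug dx dc)).map Prod.snd = augLaw₂ P := by
    have h1 := ProbabilityMeasure.tendsto_map_of_tendsto_of_continuous _ _ hlim
      (f := Prod.snd) continuous_snd
    have h2 : Tendsto (fun j => e₂ (ψ j)) atTop (𝓝 Q₂) := he₂.comp hψ.tendsto_atTop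
    have h3 : (fun j => ((g ∘ ψ) j).map (f := Prod.snd) continuous_snd.measurable.aemeasurable)
        = fun j => e₂ (ψ j) := by
      funext j
      exact Subtype.ext (hγ (ψ j)).2
    rw [h3] at h1
    rw [← hQ₂, ← tendsto_nhds_unique h1 h2]
    rfl
  have hmem : (Γ : Measure (Aug dx dc × Aug dx dc)) ∈ couplings (augLaw₁ P) (augLaw₂ P) :=
    ⟨hfst, hsnd⟩
  refine ⟨ψ, hψ, Γ, isCondOptimalPlan_of_forall_planCost_le hfin hmem fun r hr => ?_, ?_⟩
  · refine planCost_le_of_tendsto (continuous_augCost r) (augCost_nonneg hr) hlim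
      (hb.comp hψ.tendsto_atTop) ?_
    filter_upwards [(hβ.comp hψ.tendsto_atTop).eventually_ge_atTop r,
      hψ.tendsto_atTop.eventually hcost] with j hj hc
    refine le_trans (lintegral_mono fun w => ENNReal.ofReal_le_ofReal ?_) hc
    simp only [augCost, Function.comp_apply] at hj ⊢
    gcongr
    exact add_nonneg (sqDist_nonneg _ _) (sqDist_nonneg _ _)
  · exact tendsto_planW2_of_tendsto (g := g ∘ ψ) (hK.prod hK) hlim (fun j => hgK (ψ j))
      (measure_prod_compl_eq_zero_of_mem_couplings hmem (hQ₁ ▸ hQ₁K) (hQ₂ ▸ hQ₂K))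

end Limit

/-! ### The samples -/

section Samples

variable {dx dc : ℕ} {P : Measure (EuclideanSpace ℝ (Fin dx) × EuclideanSpace ℝ (Fin dc))}
  {Ω : Type*} [MeasurableSpace Ω] {μ : Measure Ω}
  {S₁ S₂ : ℕ → Ω → EuclideanSpace ℝ (Fin dx) × EuclideanSpace ℝ (Fin dc)}

lemma pairwise_indepFun_pair (hS₁ : ∀ i, HasLaw (S₁ i) P μ) (hS₂ : ∀ i, HasLaw (S₂ i) P μ)
    (hind : iIndepFun (Sum.elim S₁ S₂) μ) :
    Pairwise fun i j => IndepFun (fun ω => (S₁ i ω, S₂ i ω)) (fun ω => (S₁ j ω, S₂ j ω)) μ := by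
  intro i j hij
  have hm : ∀ k, AEMeasurable (Sum.elim S₁ S₂ k) μ := by
    rintro (k | k)
    · exact (hS₁ k).aemeasurable
    · exact (hS₂ k).aemeasurable
  exact hind.indepFun_prodMk_prodMk₀ hm (Sum.inl i) (Sum.inr i) (Sum.inl j) (Sum.inr j)
    (by simpa using hij) (by simp) (by simp) (by simpa using hij)

variable [IsProbabilityMeasure μ]

lemma hasLaw_pair (hS₁ : ∀ i, HasLaw (S₁ i) P μ) (hS₂ : ∀ i, HasLaw (S₂ i) P μ)
    (hind : iIndepFun (Sum.elim S₁ S₂) μ) (i : ℕ) :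
    HasLaw (fun ω => (S₁ i ω, S₂ i ω)) (P.prod P) μ := by
  have h : IndepFun (S₁ i) (S₂ i) μ := hind.indepFun (i := Sum.inl i) (j := Sum.inr i) (by simp)
  refine ⟨(hS₁ i).aemeasurable.prodMk (hS₂ i).aemeasurable, ?_⟩
  rw [(indepFun_iff_map_prod_eq_prod_map_map (hS₁ i).aemeasurable (hS₂ i).aemeasurable).1 h,
    (hS₁ i).map_eq, (hS₂ i).map_eq]

variable [IsProbabilityMeasure P]

/-- The first and the second augmented empirical distribution of the first `n + 1` data. -/
noncomputable def empiricalPair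
    (S₁ S₂ : ℕ → Ω → EuclideanSpace ℝ (Fin dx) × EuclideanSpace ℝ (Fin dc)) (n : ℕ)
    (ω : Ω) : ProbabilityMeasure (Aug dx dc) × ProbabilityMeasure (Aug dx dc) :=
  (empiricalPM n fun i => ((S₁ i ω).1, ((S₁ i ω).2, (S₂ i ω).2)),
    empiricalPM n fun i => ((S₂ i ω).1, ((S₁ i ω).2, (S₂ i ω).2)))

instance : IsProbabilityMeasure (augLaw₁ P) :=
  Measure.isProbabilityMeasure_map (by fun_prop)

instance : IsProbabilityMeasure (augLaw₂ P) :=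
  Measure.isProbabilityMeasure_map (by fun_prop)

/-- The pair of the population laws `Q¹` and `Q²`. -/
noncomputable def populationPair
    (P : Measure (EuclideanSpace ℝ (Fin dx) × EuclideanSpace ℝ (Fin dc))) [IsProbabilityMeasure P] :
    ProbabilityMeasure (Aug dx dc) × ProbabilityMeasure (Aug dx dc) :=
  (⟨augLaw₁ P, inferInstance⟩, ⟨augLaw₂ P, inferInstance⟩)

lemma populationPair_fst_compl_eq_zero {X : Set (EuclideanSpace ℝ (Fin dx))}
    {C : Set (EuclideanSpace ℝ (Fin dc))} (hX : MeasurableSet X) (hC : MeasurableSet C)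
    (hP : ∀ᵐ p ∂P, p.1 ∈ X ∧ p.2 ∈ C) :
    ((populationPair P).1 : Measure (Aug dx dc)) (X ×ˢ C ×ˢ C)ᶜ = 0 := by
  refine mem_ae_iff.1 (?_ : ∀ᵐ w ∂(augLaw₁ P), w ∈ X ×ˢ C ×ˢ C)
  refine (ae_map_iff (by fun_prop) (hX.prod (hC.prod hC))).2 ?_
  filter_upwards [Measure.quasiMeasurePreserving_fst.ae hP,
    Measure.quasiMeasurePreserving_snd.ae hP] with p h1 h2 using ⟨h1.1, h1.2, h2.2⟩

lemma populationPair_snd_compl_eq_zero {X : Set (EuclideanSpace ℝ (Fin dx))}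
    {C : Set (EuclideanSpace ℝ (Fin dc))} (hX : MeasurableSet X) (hC : MeasurableSet C)
    (hP : ∀ᵐ p ∂P, p.1 ∈ X ∧ p.2 ∈ C) :
    ((populationPair P).2 : Measure (Aug dx dc)) (X ×ˢ C ×ˢ C)ᶜ = 0 := by
  refine mem_ae_iff.1 (?_ : ∀ᵐ w ∂(augLaw₂ P), w ∈ X ×ˢ C ×ˢ C)
  refine (ae_map_iff (by fun_prop) (hX.prod (hC.prod hC))).2 ?_
  filter_upwards [Measure.quasiMeasurePreserving_fst.ae hP,
    Measure.quasiMeasurePreserving_snd.ae hP] with p h1 h2 using ⟨h2.1, h1.2, h2.2⟩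

lemma tendsto_measure_empiricalPair_notMem (hS₁ : ∀ i, HasLaw (S₁ i) P μ)
    (hS₂ : ∀ i, HasLaw (S₂ i) P μ) (hind : iIndepFun (Sum.elim S₁ S₂) μ)
    {U : Set (ProbabilityMeasure (Aug dx dc) × ProbabilityMeasure (Aug dx dc))}
    (hU : U ∈ 𝓝 (populationPair P)) :
    Tendsto (fun n => μ {ω | empiricalPair S₁ S₂ n ω ∉ U}) atTop (𝓝 0) := by
  obtain ⟨U₁, hU₁, U₂, hU₂, hsub⟩ := mem_nhds_prod_iff.1 hU
  have hlaw := hasLaw_pair hS₁ hS₂ hind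
  have hpair := pairwise_indepFun_pair hS₁ hS₂ hind
  let G₁ : (EuclideanSpace ℝ (Fin dx) × EuclideanSpace ℝ (Fin dc)) ×
    (EuclideanSpace ℝ (Fin dx) × EuclideanSpace ℝ (Fin dc)) → Aug dx dc :=
    fun p => (p.1.1, (p.1.2, p.2.2))
  let G₂ : (EuclideanSpace ℝ (Fin dx) × EuclideanSpace ℝ (Fin dc)) ×
    (EuclideanSpace ℝ (Fin dx) × EuclideanSpace ℝ (Fin dc)) → Aug dx dc :=
    fun p => (p.2.1, (p.1.2, p.2.2))
  have hG₁ : Measurable G₁ := by fun_prop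
  have hG₂ : Measurable G₂ := by fun_prop
  have h1 := tendsto_measure_empiricalPM_notMem (μ := μ) (Q := (populationPair P).1)
    (Y := fun i ω => G₁ (S₁ i ω, S₂ i ω))
    (fun i => HasLaw.comp ⟨hG₁.aemeasurable, rfl⟩ (hlaw i))
    (fun i j hij => (hpair hij).comp hG₁ hG₁) hU₁
  have h2 := tendsto_measure_empiricalPM_notMem (μ := μ) (Q := (populationPair P).2)
    (Y := fun i ω => G₂ (S₁ i ω, S₂ i ω))
    (fun i => HasLaw.comp ⟨hG₂.aemeasurable, rfl⟩ (hlaw i))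
    (fun i j hij => (hpair hij).comp hG₂ hG₂) hU₂
  have h := h1.add h2
  rw [add_zero] at h
  refine tendsto_of_tendsto_of_tendsto_of_le_of_le tendsto_const_nhds h (fun _ => zero_le)
    fun n => le_trans (measure_mono fun ω hω => ?_) (measure_union_le _ _)
  by_contra hcon
  simp only [Set.mem_union, Set.mem_ofPred_eq, not_or, not_not] at hcon
  exact hω (hsub ⟨hcon.1, hcon.2⟩)

/-- Sample sizes that grow fast enough compared with the weights `β k`: almost surely, the
empirical laws converge and the optimal costs for the weights `β k` asymptotically do not exceed
the conditional Wasserstein distance. -/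
theorem exists_sampleSizes {X : Set (EuclideanSpace ℝ (Fin dx))}
    {C : Set (EuclideanSpace ℝ (Fin dc))} (hX : IsCompact X) (hC : IsCompact C)
    (hP : ∀ᵐ p ∂P, p.1 ∈ X ∧ p.2 ∈ C)
    (hS₁ : ∀ i, HasLaw (S₁ i) P μ) (hS₂ : ∀ i, HasLaw (S₂ i) P μ)
    (hind : iIndepFun (Sum.elim S₁ S₂) μ) (β : ℕ → ℝ) :
    ∃ n : ℕ → ℕ, StrictMono n ∧ ∀ᵐ ω ∂μ,
      Tendsto (fun k => empiricalPair S₁ S₂ (n k) ω) atTop (𝓝 (populationPair P)) ∧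
      (∀ k, ((empiricalPair S₁ S₂ (n k) ω).1 : Measure (Aug dx dc)) (X ×ˢ C ×ˢ C)ᶜ = 0) ∧
      (∀ k, ((empiricalPair S₁ S₂ (n k) ω).2 : Measure (Aug dx dc)) (X ×ˢ C ×ˢ C)ᶜ = 0) ∧
      ∀ᶠ k in atTop, optimalCost (augCost (β k))
        ((empiricalPair S₁ S₂ (n k) ω).1 : Measure (Aug dx dc)) (empiricalPair S₁ S₂ (n k) ω).2
          ≤ condW2Sq (condLaw P) (augLaw₁ P) (augLaw₂ P) + (k : ℝ≥0∞)⁻¹ := by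
  have hfin := condW2Sq_ne_top (P := P) hX (hP.mono fun p hp => hp.1)
  set V := condW2Sq (condLaw P) (augLaw₁ P) (augLaw₂ P)
  have hK : IsCompact (X ×ˢ C ×ˢ C) := hX.prod (hC.prod hC)
  have hQ₁ := populationPair_fst_compl_eq_zero hX.measurableSet
    hC.measurableSet hP
  have hQ₂ := populationPair_snd_compl_eq_zero hX.measurableSet
    hC.measurableSet hP
  have hnear : ∀ k : ℕ, ∀ᶠ R : ProbabilityMeasure (Aug dx dc) × ProbabilityMeasure (Aug dx dc)
      in 𝓝 (populationPair P), (R.1 : Measure (Aug dx dc)) (X ×ˢ C ×ˢ C)ᶜ = 0 →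
        (R.2 : Measure (Aug dx dc)) (X ×ˢ C ×ˢ C)ᶜ = 0 →
        optimalCost (augCost (β k)) (R.1 : Measure (Aug dx dc)) R.2 ≤ V + (k : ℝ≥0∞)⁻¹ := by
    intro k
    have hk : (k : ℝ≥0∞)⁻¹ / 2 ≠ 0 := (ENNReal.half_pos (by simp)).ne'
    have hlt := ENNReal.lt_add_right hfin hk
    conv_lhs at hlt => simp only [V, condW2Sq]
    simp only [iInf_lt_iff] at hlt
    obtain ⟨Γ, hΓ, hΓV⟩ := hlt
    -- on the diagonal, the weight of the conditions is irrelevant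
    have hcost : planCost (augCost (β k)) Γ = planCost (augCost 1) Γ := by
      rw [planCost_augCost_of_mem_fourPlans hΓ, planCost_augCost_of_mem_fourPlans hΓ]
    have h := eventually_optimalCost_le hK (continuous_augCost (β k)) (populationPair P).1
      (populationPair P).2 hQ₁ hQ₂ hΓ.1 hk
    filter_upwards [h] with R hR h1 h2
    calc _ ≤ planCost (augCost (β k)) Γ + (k : ℝ≥0∞)⁻¹ / 2 := hR h1 h2
      _ ≤ V + (k : ℝ≥0∞)⁻¹ / 2 + (k : ℝ≥0∞)⁻¹ / 2 := by
        rw [hcost]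
        gcongr
      _ = _ := by rw [add_assoc, ENNReal.add_halves]
  -- shrinking the neighbourhoods along a countable basis also yields weak convergence
  obtain ⟨s, hs⟩ := (𝓝 (populationPair P)).exists_antitone_basis
  obtain ⟨n, hn, hae⟩ := exists_strictMono_ae_eventually_notMem
    (B := fun k n => {ω | empiricalPair S₁ S₂ n ω ∉ s k ∩ {R | _}}) fun k =>
    tendsto_measure_empiricalPair_notMem hS₁ hS₂ hind (inter_mem (hs.mem k) (hnear k))
  have hd₁ : ∀ᵐ ω ∂μ, ∀ i, (S₁ i ω).1 ∈ X ∧ (S₁ i ω).2 ∈ C :=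
    ae_all_iff.2 fun i => ae_of_ae_map (hS₁ i).aemeasurable ((hS₁ i).map_eq.symm ▸ hP)
  have hd₂ : ∀ᵐ ω ∂μ, ∀ i, (S₂ i ω).1 ∈ X ∧ (S₂ i ω).2 ∈ C :=
    ae_all_iff.2 fun i => ae_of_ae_map (hS₂ i).aemeasurable ((hS₂ i).map_eq.symm ▸ hP)
  refine ⟨n, hn, ?_⟩
  filter_upwards [hae, hd₁, hd₂] with ω hω h1 h2
  have hs₁ : ∀ k, ((empiricalPair S₁ S₂ (n k) ω).1 : Measure (Aug dx dc)) (X ×ˢ C ×ˢ C)ᶜ = 0 :=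
    fun k => mem_ae_iff.1 (ae_empirical fun i => ⟨(h1 i).1, (h1 i).2, (h2 i).2⟩)
  have hs₂ : ∀ k, ((empiricalPair S₁ S₂ (n k) ω).2 : Measure (Aug dx dc)) (X ×ˢ C ×ˢ C)ᶜ = 0 :=
    fun k => mem_ae_iff.1 (ae_empirical fun i => ⟨(h2 i).1, (h1 i).2, (h2 i).2⟩)
  have hω' : ∀ᶠ k in atTop, empiricalPair S₁ S₂ (n k) ω ∈ s k ∩ {R | _} :=
    hω.mono fun k hk => not_not.1 hk
  refine ⟨hs.toHasBasis.tendsto_right_iff.2 fun i _ => ?_, hs₁, hs₂, ?_⟩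
  · filter_upwards [hω', eventually_ge_atTop i] with k hk hik
    exact hs.antitone hik hk.1
  · filter_upwards [hω'] with k hk
    exact hk.2 (hs₁ k) (hs₂ k)

end Samples

end A2A

theorem mainTheorem1 {dx dc : ℕ}
    (X : Set (EuclideanSpace ℝ (Fin dx))) (C : Set (EuclideanSpace ℝ (Fin dc)))
    (hX : IsCompact X) (hC : IsCompact C)
    (P : Measure (EuclideanSpace ℝ (Fin dx) × EuclideanSpace ℝ (Fin dc)))
    [IsProbabilityMeasure P] (hP : ∀ᵐ p ∂P, p.1 ∈ X ∧ p.2 ∈ C)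
    -- `Pc c` is the regular conditional distribution of `X` given `C = c` (any version)
    (Pc : Kernel (EuclideanSpace ℝ (Fin dc)) (EuclideanSpace ℝ (Fin dx)))
    [IsMarkovKernel Pc] [(P.map Prod.swap).IsCondKernel Pc]
    -- two independent i.i.d. samples with law `P`
    {Ω : Type*} [MeasurableSpace Ω] (μ : Measure Ω) [IsProbabilityMeasure μ]
    (S₁ S₂ : ℕ → Ω → EuclideanSpace ℝ (Fin dx) × EuclideanSpace ℝ (Fin dc))
    (hS₁ : ∀ i, HasLaw (S₁ i) P μ) (hS₂ : ∀ i, HasLaw (S₂ i) P μ)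
    (hind : iIndepFun (Sum.elim S₁ S₂) μ)
    (β : ℕ → ℝ) (hβ_pos : ∀ k, 0 < β k) (hβ : Tendsto β atTop atTop) :
    -- convergence of the empirical optimal couplings
    (∃ N : ℕ → ℕ, StrictMono N ∧ (∀ k, 0 < N k) ∧
      ∀ᵐ ω ∂μ, ∀ γ : ℕ → Measure (A2A.Aug dx dc × A2A.Aug dx dc),
        (∀ k, A2A.IsEmpiricalOptimal (N k) (fun i => S₁ i ω) (fun i => S₂ i ω) (β k) (γ k)) →
        -- every subsequence has a further subsequence that converges to an optimal plan
        (∀ φ : ℕ → ℕ, StrictMono φ → ∃ ψ : ℕ → ℕ, StrictMono ψ ∧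
          ∃ Γ : Measure (A2A.Aug dx dc × A2A.Aug dx dc),
            A2A.IsCondOptimalPlan (A2A.condLaw P) (A2A.augLaw₁ P) (A2A.augLaw₂ P) Γ ∧
            Tendsto (fun j => A2A.planW2 (γ (φ (ψ j))) Γ) atTop (𝓝 0)) ∧
        -- the whole sequence converges if the optimal plan is unique
        (∀ Γ : Measure (A2A.Aug dx dc × A2A.Aug dx dc),
          A2A.IsCondOptimalPlan (A2A.condLaw P) (A2A.augLaw₁ P) (A2A.augLaw₂ P) Γ →
          (∀ Γ' : Measure (A2A.Aug dx dc × A2A.Aug dx dc),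
            A2A.IsCondOptimalPlan (A2A.condLaw P) (A2A.augLaw₁ P) (A2A.augLaw₂ P) Γ' → Γ' = Γ) →
          Tendsto (fun k => A2A.planW2 (γ k) Γ) atTop (𝓝 0))) ∧
    -- the disintegration `K` (any version) of every such optimal plan
    (∀ Γ : Measure (A2A.Aug dx dc × A2A.Aug dx dc),
      A2A.IsCondOptimalPlan (A2A.condLaw P) (A2A.augLaw₁ P) (A2A.augLaw₂ P) Γ →
      ∀ K : Kernel (A2A.CondPair dc)
          (EuclideanSpace ℝ (Fin dx) × EuclideanSpace ℝ (Fin dx)),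
        IsMarkovKernel K → (A2A.threePlan Γ).IsCondKernel K →
        (∫⁻ z, A2A.planCost A2A.sqDist (K z) ∂(A2A.condLaw P)
          = ∫⁻ z, A2A.optimalCost A2A.sqDist (Pc z.1) (Pc z.2) ∂(A2A.condLaw P)) ∧
        (∀ᵐ z ∂(A2A.condLaw P),
          A2A.IsOptimalPlan A2A.sqDist (Pc z.1) (Pc z.2) (K z))) := by
  have hPX : ∀ᵐ p ∂P, p.1 ∈ X := hP.mono fun p hp => hp.1
  refine ⟨?_, fun Γ hΓ K hK hdis => ?_⟩
  · obtain ⟨n, hn, hae⟩ := A2A.exists_sampleSizes hX hC hP hS₁ hS₂ hind β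
    -- the index `n` of an empirical law stands for `n + 1` data points
    refine ⟨fun k => n k + 1, fun i j hij => Nat.succ_lt_succ (hn hij), fun k => Nat.succ_pos _, ?_⟩
    filter_upwards [hae] with ω ⟨hlim, hK₁, hK₂, hcost⟩ γ hγ
    have hopt := fun k => (hγ k).isOptimalPlan (Nat.succ_pos _) (hβ_pos k).le
    have hsub : ∀ φ : ℕ → ℕ, StrictMono φ → ∃ ψ : ℕ → ℕ, StrictMono ψ ∧
        ∃ Γ : Measure (A2A.Aug dx dc × A2A.Aug dx dc),
          A2A.IsCondOptimalPlan (A2A.condLaw P) (A2A.augLaw₁ P) (A2A.augLaw₂ P) Γ ∧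
          Tendsto (fun j => A2A.planW2 (γ (φ (ψ j))) Γ) atTop (𝓝 0) := by
      intro φ hφ
      have hb : Tendsto (fun k : ℕ => A2A.condW2Sq (A2A.condLaw P) (A2A.augLaw₁ P) (A2A.augLaw₂ P)
          + (k : ℝ≥0∞)⁻¹) atTop
          (𝓝 (A2A.condW2Sq (A2A.condLaw P) (A2A.augLaw₁ P) (A2A.augLaw₂ P))) := by
        simpa using tendsto_const_nhds.add ENNReal.tendsto_inv_nat_nhds_zero
      have hcost' := hφ.tendsto_atTop.eventually hcost
      exact A2A.exists_subseq_tendsto_isCondOptimalPlan (A2A.condW2Sq_ne_top hX hPX)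
        (Q₁ := (A2A.populationPair P).1) (Q₂ := (A2A.populationPair P).2) rfl rfl
        (K := X ×ˢ C ×ˢ C) (hX.prod (hC.prod hC))
        (A2A.populationPair_fst_compl_eq_zero hX.measurableSet hC.measurableSet hP)
        (A2A.populationPair_snd_compl_eq_zero hX.measurableSet hC.measurableSet hP)
        (e₁ := fun j => (A2A.empiricalPair S₁ S₂ (n (φ j)) ω).1)
        (e₂ := fun j => (A2A.empiricalPair S₁ S₂ (n (φ j)) ω).2)
        ((continuous_fst.tendsto _).comp (hlim.comp hφ.tendsto_atTop))
        ((continuous_snd.tendsto _).comp (hlim.comp hφ.tendsto_atTop))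
        (fun j => hK₁ (φ j)) (fun j => hK₂ (φ j)) (hβ.comp hφ.tendsto_atTop)
        (γ := fun j => γ (φ j)) (fun j => (hopt (φ j)).1) (hb.comp hφ.tendsto_atTop)
        (hcost'.mono fun j hj => (hopt (φ j)).2.trans_le hj)
    refine ⟨hsub, fun Γ hΓ huniq => Filter.tendsto_of_subseq_tendsto fun ns hns => ?_⟩
    -- all limits of subsequences are equal to `Γ` by uniqueness
    obtain ⟨φ, -, hφ⟩ := strictMono_subseq_of_tendsto_atTop hns
    obtain ⟨ψ, -, Γ', hΓ', hlim'⟩ := hsub (ns ∘ φ) hφ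
    rw [huniq Γ' hΓ'] at hlim'
    exact ⟨φ ∘ ψ, hlim'⟩
  · have hae := A2A.ae_isOptimalPlan_of_isCondOptimalPlan (Pc := Pc) hX hPX hΓ K
    exact ⟨lintegral_congr_ae (hae.mono fun z hz => hz.2), hae⟩
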